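/- Let $X$ be a closed (compact, connected) Riemann surface and let $L$ be a holomorphic line bundle on $X$. An $L$-twisted $\operatorname{Sp}(2n,\mathbb C)$-Higgs pair $((W,\Omega),\Phi)$ consists of a holomorphic vector bundle $W$ of rank $2n$ on $X$, a fibrewise nondegenerate holomorphic section $\Omega$ of $\Lambda^2W^*$, and a section $\Phi\in H^0(L\otimes\mathfrak{sp}(W))$, where $\mathfrak{sp}(W)=\{\xi\in\operatorname{End}W : \Omega(\xi\cdot,\cdot)+\Omega(\cdot,\xi\cdot)=0\}$. Consider filtrations by holomorphic subbundles $\mathcal W=(0=W_0\subsetneq W_1\subsetneq\dots\subsetneq W_k=W)$ with $W_{k-i}=W_i^{\perp_\Omega}$ for all $i$, and weights $\lambda\in\Lambda(\mathcal W)=\{\lambda\in\mathbb R^k : \lambda_i\le\lambda_{i+1},\ \lambda_{k-i+1}+\lambda_i=0\}$. Put $d(\mathcal W,\lambda)=\sum_{j=1}^{k-1}(\lambda_j-\lambda_{j+1})\deg W_j$, and let $N(\mathcal W,\lambda)\subset L\otimes\mathfrak{sp}(W)$ be the subbundle of those elements which map each $W_i$ into $L\otimes\sum_{j:\lambda_j\le\lambda_i}W_j$.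 The pair $((W,\Omega),\Phi)$ is called - semistable if $d(\mathcal W,\lambda)\ge 0$ for all such $\mathcal W$ and $\lambda\in\Lambda(\mathcal W)$ with $\Phi\in H^0(N(\mathcal W,\lambda))$; - stable if it is semistable and $d(\mathcal W,\lambda)>0$ for all such $\mathcal W$ and nonzero $\lambda\in\Lambda(\mathcal W)$ with $\Phi\in H^0(N(\mathcal W,\lambda))$; - polystable if it is semistable and, for all such $\mathcal W$ and all $\lambda\in\Lambda(\mathcal W)$ with $\lambda_1<\dots<\lambda_k$, $\Phi\in H^0(N(\mathcal W,\lambda))$ and $d(\mathcal W,\lambda)=0$, there is a holomorphic splitting $W\simeq\bigoplus_i W_i/W_{i-1}$ of the filtration such that $\Omega$ pairs $W_i/W_{i-1}$ and $W_j/W_{j-1}$ to zero unless $i+j=k+1$, and $\Phi\in H^0(\bigoplus_i L\otimes\operatorname{Hom}(W_i/W_{i-1},W_i/W_{i-1}))$. A subbundle $W'\subset W$ is isotropic if $\Omega|_{W'}=0$, and $\Phi$-invariant if $\Phi(W')\subset L\otimes W'$. Theorem. 1. $((W,\Omega),\Phi)$ is semistable if and only if $\deg W'\le 0$ for every $\Phi$-invariant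 isotropic subbundle $W'\subset W$. 2. $((W,\Omega),\Phi)$ is stable if and only if $\deg W'<0$ for every nonzero, strict $\Phi$-invariant isotropic subbundle $W'\subset W$. 3. $((W,\Omega),\Phi)$ is polystable if it is semistable and for every nonzero, strict $\Phi$-invariant isotropic subbundle $W'\subset W$ with $\deg W'=0$ there is a $\Phi$-invariant isotropic subbundle $W''\subset W$ with $W=W'\oplus W''$. 4. $((W,\Omega),\Phi)$ is polystable if and only if it is semistable and for every nonzero, strict $\Phi$-invariant isotropic subbundle $W'\subset W$ with $\deg W'=0$ there is a $\Phi$-invariant isotropic subbundle $W''\subset W$ with $W=W'^{\perp_\Omega}\oplus W''$. -/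

import Mathlib

open Bundle Set
open scoped Manifold ContDiff Topology

noncomputable section

namespace SpHiggs

/-! ## Holomorphic subbundles and their degree

`X` is a Riemann surface, i.e. a complex manifold modelled on `ℂ` (`IsManifold 𝓘(ℂ) ω X`, where
`ω` means complex analytic), and `W` is a holomorphic vector bundle on `X` with typical fibre `F`
(`ContMDiffVectorBundle ω F W 𝓘(ℂ)`). -/

section Subbundles

variable {X : Type*} [TopologicalSpace X] [ChartedSpace ℂ X]
  {F : Type*} [NormedAddCommGroup F] [NormedSpace ℂ F]
  {W : X → Type*} [TopologicalSpace (TotalSpace F W)]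
  [∀ x, AddCommGroup (W x)] [∀ x, Module ℂ (W x)] [∀ x, TopologicalSpace (W x)]
  [FiberBundle F W]

variable (F) in
/-- The section `s` of `W` is holomorphic on the set `U`. -/
def IsHolSection (U : Set X) (s : ∀ x, W x) : Prop :=
  ContMDiffOn 𝓘(ℂ) (𝓘(ℂ).prod 𝓘(ℂ, F)) ω (fun x => TotalSpace.mk' F x (s x)) U

variable (F) in
/-- A holomorphic frame, on an open neighbourhood of `x₀`, of a family `S` of linear subspaces of
the fibres of `W`. -/
structure HolFrame (S : ∀ x, Submodule ℂ (W x)) (x₀ : X) where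
  /-- the open set on which the frame is defined -/
  dom : Set X
  isOpen_dom : IsOpen dom
  mem_dom : x₀ ∈ dom
  /-- the number of sections in the frame -/
  rank : ℕ
  /-- the sections of the frame -/
  sec : Fin rank → ∀ x, W x
  hol : ∀ i, IsHolSection F dom (sec i)
  linearIndependent : ∀ x ∈ dom, LinearIndependent ℂ fun i => sec i x
  span_eq : ∀ x ∈ dom, Submodule.span ℂ (range fun i => sec i x) = S x

variable (F W) in
/-- A holomorphic subbundle of `W`: a family of linear subspaces of the fibres which has a
holomorphic frame near every point. -/
structure HolSubbundle where
  /-- the fibre of the subbundle -/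
  fiber : ∀ x, Submodule ℂ (W x)
  exists_frame : ∀ x, Nonempty (HolFrame F fiber x)

variable (F W) in
/-- A smooth Hermitian metric on the holomorphic vector bundle `W`: a Hermitian inner product on
each fibre such that the product of any two local holomorphic sections is a smooth function (in the
real sense). -/
structure HermitianMetric where
  /-- the inner product on the fibre at `x` -/
  core : ∀ x, InnerProductSpace.Core ℂ (W x)
  smooth : ∀ (U : Set X) (s t : ∀ x, W x), IsOpen U → IsHolSection F U s → IsHolSection F U t →
    ContMDiffOn 𝓘(ℝ, ℂ) 𝓘(ℝ, ℂ) ∞ (fun x => (core x).inner (s x) (t x)) U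

/-- `log det (h (eᵢ, eⱼ))` for a holomorphic frame `e`, as a function on the domain of `e`: the
logarithm of the squared norm of the section `e₁ ∧ ⋯ ∧ e_r` of the determinant line bundle. -/
def logGram (h : HermitianMetric F W) {S : ∀ x, Submodule ℂ (W x)} {x₀ : X}
    (e : HolFrame F S x₀) (x : X) : ℝ :=
  Real.log (Matrix.of fun i j => (h.core x).inner (e.sec i x) (e.sec j x)).det.re

/-- Let `φ` be a holomorphic chart with coordinate `z = a + i b`, and let `e x` be a holomorphic
frame of `S` near `x` for each `x`. This is the coefficient of `da ∧ db` in the first Chern form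
`(i / 2π) tr Θ = -(i / 2π) ∂ ∂̄ log det (h (eᵢ, eⱼ)) = -(1 / 4π) Δ (log det (h (eᵢ, eⱼ))) da ∧ db`
of the Chern connection of the metric induced on `S` by the metric `h` of `W`. It does not depend
on the frames. -/
def chernDensity (h : HermitianMetric F W) {S : ∀ x, Submodule ℂ (W x)}
    (e : ∀ x, HolFrame F S x) (φ : OpenPartialHomeomorph X ℂ) (z : ℂ) : ℝ :=
  -(1 / (4 * Real.pi)) *
    (Laplacian.laplacian (fun w : ℂ => logGram h (e (φ.symm z)) (φ.symm w)) : ℂ → ℝ) z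

/-- `d = ∫_X c₁(S, h)`, the integral over `X` of the first Chern form of `S` for the metric
induced by some Hermitian metric `h` on `W`. The integral of a `2`-form over `X` is computed by
means of a smooth partition of unity subordinate to the charts. -/
def HasDegree (S : HolSubbundle F W) (d : ℝ) : Prop :=
  ∃ (h : HermitianMetric F W) (e : ∀ x, HolFrame F S.fiber x)
    (ρ : SmoothPartitionOfUnity X 𝓘(ℝ, ℂ) X univ),
    ρ.IsSubordinate (fun x => (chartAt ℂ x).source) ∧
    d = ∑ᶠ i : X, ∫ z in (chartAt ℂ i).target,
      ρ i ((chartAt ℂ i).symm z) * chernDensity h e (chartAt ℂ i) z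

/-- The degree of a holomorphic subbundle of a holomorphic vector bundle on a closed Riemann
surface (by Chern-Weil theory: it exists, and does not depend on the metric, the frames or the
partition of unity). -/
def HolSubbundle.degree (S : HolSubbundle F W) : ℝ :=
  Classical.epsilon (HasDegree S)

end Subbundles

/-! ## Symplectic Higgs pairs -/

section Pairs

variable (X : Type*) [TopologicalSpace X] [ChartedSpace ℂ X]
  (n : ℕ)
  (L : X → Type*) [TopologicalSpace (TotalSpace ℂ L)]
  [∀ x, AddCommGroup (L x)] [∀ x, Module ℂ (L x)] [∀ x, TopologicalSpace (L x)]
  [∀ x, IsTopologicalAddGroup (L x)] [∀ x, ContinuousSMul ℂ (L x)]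
  [FiberBundle ℂ L] [VectorBundle ℂ ℂ L]
  (W : X → Type*) [TopologicalSpace (TotalSpace (Fin (2 * n) → ℂ) W)]
  [∀ x, AddCommGroup (W x)] [∀ x, Module ℂ (W x)] [∀ x, TopologicalSpace (W x)]
  [∀ x, IsTopologicalAddGroup (W x)] [∀ x, ContinuousSMul ℂ (W x)]
  [FiberBundle (Fin (2 * n) → ℂ) W] [VectorBundle ℂ (Fin (2 * n) → ℂ) W]

/-- The structure of an `L`-twisted `Sp(2n, ℂ)`-Higgs pair on the rank `2n` bundle `W`: a
holomorphic symplectic form `Ω` and a holomorphic section `Φ` of `L ⊗ 𝔰𝔭(W, Ω)`. We use the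
canonical isomorphism `L ⊗ End W = Hom (L*, End W)`. -/
structure HiggsPair where
  /-- the symplectic form -/
  Ω : ∀ x, W x →L[ℂ] W x →L[ℂ] ℂ
  hol_Ω : ContMDiff 𝓘(ℂ) (𝓘(ℂ).prod 𝓘(ℂ, (Fin (2 * n) → ℂ) →L[ℂ] (Fin (2 * n) → ℂ) →L[ℂ] ℂ)) ω
    (fun x => TotalSpace.mk' ((Fin (2 * n) → ℂ) →L[ℂ] (Fin (2 * n) → ℂ) →L[ℂ] ℂ)
      (E := fun x => W x →L[ℂ] W x →L[ℂ] Trivial X ℂ x) x (Ω x))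
  alternating : ∀ x v, Ω x v v = 0
  nondegenerate : ∀ x v, (∀ w, Ω x v w = 0) → v = 0
  /-- the Higgs field -/
  Φ : ∀ x, (L x →L[ℂ] ℂ) →L[ℂ] W x →L[ℂ] W x
  hol_Φ : ContMDiff 𝓘(ℂ)
    (𝓘(ℂ).prod 𝓘(ℂ, (ℂ →L[ℂ] ℂ) →L[ℂ] (Fin (2 * n) → ℂ) →L[ℂ] (Fin (2 * n) → ℂ))) ω
    (fun x => TotalSpace.mk' ((ℂ →L[ℂ] ℂ) →L[ℂ] (Fin (2 * n) → ℂ) →L[ℂ] (Fin (2 * n) → ℂ))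
      (E := fun x => (L x →L[ℂ] Trivial X ℂ x) →L[ℂ] W x →L[ℂ] W x) x (Φ x))
  symplectic : ∀ x ξ v w, Ω x (Φ x ξ v) w + Ω x v (Φ x ξ w) = 0

end Pairs

namespace HiggsPair

variable {X : Type*} [TopologicalSpace X] [ChartedSpace ℂ X]
  {n : ℕ}
  {L : X → Type*} [TopologicalSpace (TotalSpace ℂ L)]
  [∀ x, AddCommGroup (L x)] [∀ x, Module ℂ (L x)] [∀ x, TopologicalSpace (L x)]
  [∀ x, IsTopologicalAddGroup (L x)] [∀ x, ContinuousSMul ℂ (L x)]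
  [FiberBundle ℂ L] [VectorBundle ℂ ℂ L]
  {W : X → Type*} [TopologicalSpace (TotalSpace (Fin (2 * n) → ℂ) W)]
  [∀ x, AddCommGroup (W x)] [∀ x, Module ℂ (W x)] [∀ x, TopologicalSpace (W x)]
  [∀ x, IsTopologicalAddGroup (W x)] [∀ x, ContinuousSMul ℂ (W x)]
  [FiberBundle (Fin (2 * n) → ℂ) W] [VectorBundle ℂ (Fin (2 * n) → ℂ) W]
  (P : HiggsPair X n L W)

/-- The perpendicular of the subspace `S` of `W x` with respect to `Ω`. -/
def perp {x : X} (S : Submodule ℂ (W x)) : Submodule ℂ (W x) where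
  carrier := {v | ∀ w ∈ S, P.Ω x v w = 0}
  add_mem' := by
    intro a b ha hb w hw
    simp [ha w hw, hb w hw]
  zero_mem' := by
    intro w _
    simp
  smul_mem' := by
    intro c a ha w hw
    simp [ha w hw]

/-- `Ω` vanishes on the subbundle `S`. -/
def IsIsotropic (S : HolSubbundle (Fin (2 * n) → ℂ) W) : Prop :=
  ∀ x, ∀ v ∈ S.fiber x, ∀ w ∈ S.fiber x, P.Ω x v w = 0

/-- `Φ(S) ⊆ L ⊗ S`. -/
def IsInvariant (S : HolSubbundle (Fin (2 * n) → ℂ) W) : Prop :=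
  ∀ x ξ, ∀ v ∈ S.fiber x, P.Φ x ξ v ∈ S.fiber x

/-- A filtration `0 = W₀ ⊊ W₁ ⊊ ⋯ ⊊ W_k = W` by holomorphic subbundles, of length `k = m + 1`, with
`W_{k - i}` the perpendicular of `W_i` for every `i` (`Fin.rev i` is `k - i`). -/
structure Filtration (m : ℕ) where
  /-- the terms of the filtration -/
  sub : Fin (m + 2) → HolSubbundle (Fin (2 * n) → ℂ) W
  strict : StrictMono fun i => (sub i).fiber
  bot : ∀ x, (sub 0).fiber x = ⊥
  top : ∀ x, (sub (Fin.last (m + 1))).fiber x = ⊤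
  perp_eq : ∀ i x, (sub i.rev).fiber x = P.perp ((sub i).fiber x)

/-- The set `Λ` of weights `lam = (λ₁ ≤ ⋯ ≤ λ_k)`, with `k = m + 1` and `λ_{k - i + 1} + λ_i = 0`.
The indices are shifted by one: `lam i` is `λ_{i + 1}`. -/
def weights (m : ℕ) : Set (Fin (m + 1) → ℝ) :=
  {lam | Monotone lam ∧ ∀ i : Fin (m + 1), lam i.rev + lam i = 0}

variable {P} in
/-- `Φ` is a section of `N(𝒲, λ)`, the part of `L ⊗ 𝔰𝔭(W)` contained in the sum over
`λ_i ≥ λ_j` of the `L ⊗ Hom (W_i, W_j)`: the endomorphisms which map `W_i`, for each `i`, to the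
sum of the `W_j` with `λ_j ≤ λ_i`. In terms of the graded pieces, the component from
`W_i / W_{i-1}` to `W_j / W_{j-1}` may be nonzero only if `λ_i ≥ λ_j`. -/
def Filtration.Compatible {m : ℕ} (𝒲 : P.Filtration m) (lam : Fin (m + 1) → ℝ) : Prop :=
  ∀ x ξ, ∀ i : Fin (m + 1), ∀ v ∈ (𝒲.sub i.succ).fiber x,
    P.Φ x ξ v ∈ ⨆ (j : Fin (m + 1)) (_ : lam j ≤ lam i), (𝒲.sub j.succ).fiber x

variable {P} in
/-- `d(𝒲, λ) = ∑_{j = 1}^{k - 1} (λ_j - λ_{j + 1}) deg W_j`, where `k = m + 1`. -/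
def Filtration.deg {m : ℕ} (𝒲 : P.Filtration m) (lam : Fin (m + 1) → ℝ) : ℝ :=
  ∑ j : Fin m, (lam j.castSucc - lam j.succ) * (𝒲.sub j.succ.castSucc).degree

variable {P} in
/-- There is a holomorphic splitting `W ≃ W₁ ⊕ W₂ / W₁ ⊕ ⋯ ⊕ W_k / W_{k-1}` of the filtration such
that `Ω` pairs the `i`-th and the `j`-th summand to zero unless `i + j = k + 1`, and with respect to
which `Φ` is diagonal. The splitting is given by subbundles `V₁, …, V_k` of `W` with
`W_i = W_{i-1} ⊕ V_i` (so that `V_i` is mapped isomorphically to `W_i / W_{i-1}`). -/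
def Filtration.Splits {m : ℕ} (𝒲 : P.Filtration m) : Prop :=
  ∃ V : Fin (m + 1) → HolSubbundle (Fin (2 * n) → ℂ) W,
    (∀ i x, Disjoint ((𝒲.sub i.castSucc).fiber x) ((V i).fiber x) ∧
      (𝒲.sub i.castSucc).fiber x ⊔ (V i).fiber x = (𝒲.sub i.succ).fiber x) ∧
    (∀ i j, j ≠ Fin.rev i → ∀ x, ∀ v ∈ (V i).fiber x, ∀ w ∈ (V j).fiber x, P.Ω x v w = 0) ∧
    ∀ i, P.IsInvariant (V i)

/-- Semistability. -/
def IsSemistable : Prop :=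
  ∀ (m : ℕ) (𝒲 : P.Filtration m), ∀ lam ∈ weights m, 𝒲.Compatible lam → 0 ≤ 𝒲.deg lam

/-- Stability. -/
def IsStable : Prop :=
  P.IsSemistable ∧
    ∀ (m : ℕ) (𝒲 : P.Filtration m), ∀ lam ∈ weights m, lam ≠ 0 → 𝒲.Compatible lam →
      0 < 𝒲.deg lam

/-- Polystability. -/
def IsPolystable : Prop :=
  P.IsSemistable ∧
    ∀ (m : ℕ) (𝒲 : P.Filtration m), ∀ lam ∈ weights m, StrictMono lam → 𝒲.Compatible lam →
      𝒲.deg lam = 0 → 𝒲.Splits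

end HiggsPair

/-- A subbundle is nonzero and strict (different from the whole bundle). -/
def HolSubbundle.IsProper {X : Type*} [TopologicalSpace X] [ChartedSpace ℂ X]
    {F : Type*} [NormedAddCommGroup F] [NormedSpace ℂ F]
    {W : X → Type*} [TopologicalSpace (TotalSpace F W)]
    [∀ x, AddCommGroup (W x)] [∀ x, Module ℂ (W x)] [∀ x, TopologicalSpace (W x)]
    [FiberBundle F W] (S : HolSubbundle F W) : Prop :=
  (∃ x, S.fiber x ≠ ⊥) ∧ ∃ x, S.fiber x ≠ ⊤

end SpHiggs

end

noncomputable section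

namespace SpHiggs

set_option linter.unusedSectionVars false

/-! ## Matrices of functions on a manifold -/

section Matrices

variable {𝕜 : Type*} [NontriviallyNormedField 𝕜] [NormedAlgebra 𝕜 ℂ]
  {E : Type*} [NormedAddCommGroup E] [NormedSpace 𝕜 E] {H : Type*} [TopologicalSpace H]
  {I : ModelWithCorners 𝕜 E H} {M : Type*} [TopologicalSpace M] [ChartedSpace H M]
  {ι : Type*} [Fintype ι] [DecidableEq ι] {k : WithTop ℕ∞} {U : Set M}
  {A : M → Matrix ι ι ℂ}

/-! The proof rests on one fact about degrees and one about splittings.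

Degrees: a proper subbundle `S` and its perpendicular have the same degree (`degree_perpBundle`),
since `Ω` makes `W / S` dual to `S^⊥` and trivializes `det W`. As `degree` is a choice among the
values allowed by `HasDegree`, it suffices that `S` and `S^⊥` allow the same values. A metric that
computes one is changed conformally into a metric that computes the other with the same Chern
density at every point: the logarithms of the Gram determinants then differ by `log |det Ω(vᵢ,
vⱼ)|`, which is harmonic because the determinant is holomorphic without zeros.

Semistability and stability follow. Where the weights jump, the term of the filtration is invariant;
it or its perpendicular is isotropic, and the two have equal degrees, so every summand of `d` has
its sign controlled. Conversely, an invariant isotropic `S` gives the filtration `0 ⊂ S ⊆ S^⊥ ⊂ W`,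
with `d = -2 deg S` (`exists_filtration`).

Polystability: strictly increasing weights with `d = 0` make all intermediate terms `W_i` invariant
of degree zero. If `T_i` is an isotropic invariant complement of `W_i^⊥`, then `T_i^⊥` is an
invariant complement of `W_i`. Such complements of the isotropic terms are made decreasing by the
modular law and prolonged by duality to a filtration `A` opposite to `W`
(`exists_opposite_filtration`); the intersections `W_{i+1} ∩ A_i` split `W` (`exists_splitting`).
Conversely, the last summand of a splitting of the filtration of `S` is the required complement of
`S^⊥`. The third claim reduces to the fourth, since an isotropic complement of an isotropic `S` is
also one of `S^⊥`. -/

lemma contMDiffOn_det (hA : ∀ i j, ContMDiffOn I 𝓘(𝕜, ℂ) k (fun x => A x i j) U) :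
    ContMDiffOn I 𝓘(𝕜, ℂ) k (fun x => (A x).det) U := by
  have h : ContDiff 𝕜 k (fun B : ι → ι → ℂ => (Matrix.of B).det) := by
    simp only [Matrix.det_apply', Matrix.of_apply]
    exact ContDiff.sum fun σ _ => contDiff_const.mul (contDiff_prod fun i _ => by fun_prop)
  exact h.contMDiff.comp_contMDiffOn
    (contMDiffOn_pi_space.2 fun i => contMDiffOn_pi_space.2 fun j => hA i j)

lemma contMDiffOn_matrix_inv (hA : ∀ i j, ContMDiffOn I 𝓘(𝕜, ℂ) k (fun x => A x i j) U)
    (hdet : ∀ x ∈ U, (A x).det ≠ 0) (i j : ι) :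
    ContMDiffOn I 𝓘(𝕜, ℂ) k (fun x => (A x)⁻¹ i j) U := by
  have hadj : ContMDiffOn I 𝓘(𝕜, ℂ) k (fun x => (A x).adjugate i j) U := by
    -- An entry of the adjugate is the determinant of `A` with one row replaced by a constant row.
    simp only [Matrix.adjugate_apply]
    refine contMDiffOn_det fun a b => ?_
    by_cases ha : a = j
    · subst ha
      simpa using contMDiffOn_const
    · simpa [Matrix.updateRow_ne ha] using hA a b
  have hinv : ContMDiffOn I 𝓘(𝕜, ℂ) k (fun x => ((A x).det)⁻¹) U := fun x hx =>
    ((contDiffAt_inv 𝕜 (hdet x hx)).contMDiffAt).comp_contMDiffWithinAt x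
      (contMDiffOn_det hA x hx)
  refine ((contDiff_mul (𝕜 := 𝕜) (𝔸 := ℂ)).contMDiff.comp_contMDiffOn
    (hinv.prodMk_space hadj)).congr fun x hx => ?_
  simp [Matrix.inv_def]

end Matrices

namespace HiggsPair

/-! ### Linear algebra of perpendiculars in a fibre. -/

section Fibers

variable {X : Type*} [TopologicalSpace X] [ChartedSpace ℂ X]
  {n : ℕ}
  {L : X → Type*} [TopologicalSpace (TotalSpace ℂ L)]
  [∀ x, AddCommGroup (L x)] [∀ x, Module ℂ (L x)] [∀ x, TopologicalSpace (L x)]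
  [∀ x, IsTopologicalAddGroup (L x)] [∀ x, ContinuousSMul ℂ (L x)]
  [FiberBundle ℂ L] [VectorBundle ℂ ℂ L]
  {W : X → Type*} [TopologicalSpace (TotalSpace (Fin (2 * n) → ℂ) W)]
  [∀ x, AddCommGroup (W x)] [∀ x, Module ℂ (W x)] [∀ x, TopologicalSpace (W x)]
  [∀ x, IsTopologicalAddGroup (W x)] [∀ x, ContinuousSMul ℂ (W x)]
  [FiberBundle (Fin (2 * n) → ℂ) W] [VectorBundle ℂ (Fin (2 * n) → ℂ) W]
  (P : HiggsPair X n L W)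

/-- The symplectic form on a fibre, as a bilinear form. -/
def bilin (x : X) : LinearMap.BilinForm ℂ (W x) :=
  LinearMap.mk₂ ℂ (fun v w => P.Ω x v w) (by simp) (by simp) (by simp) (by simp)

@[simp] lemma bilin_apply (x : X) (v w : W x) : P.bilin x v w = P.Ω x v w := rfl

lemma Ω_swap (x : X) (v w : W x) : P.Ω x v w = -P.Ω x w v := by
  have h := P.alternating x (v + w)
  simp only [map_add, add_apply, P.alternating, zero_add, add_zero] at h
  exact eq_neg_of_add_eq_zero_right h

lemma Ω_eq_zero_comm {x : X} {v w : W x} : P.Ω x v w = 0 ↔ P.Ω x w v = 0 := by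
  rw [P.Ω_swap, neg_eq_zero]

lemma bilin_isRefl (x : X) : (P.bilin x).IsRefl := fun _ _ h => P.Ω_eq_zero_comm.1 h

lemma bilin_nondegenerate (x : X) : (P.bilin x).Nondegenerate :=
  ⟨fun v h => P.nondegenerate x v h, fun v h =>
    P.nondegenerate x v fun w => P.Ω_eq_zero_comm.1 (h w)⟩

lemma perp_eq_orthogonal {x : X} (S : Submodule ℂ (W x)) :
    P.perp S = (P.bilin x).orthogonal S := by
  ext v
  exact forall₂_congr fun w _ => P.Ω_eq_zero_comm

lemma mem_perp {x : X} {S : Submodule ℂ (W x)} {v : W x} :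
    v ∈ P.perp S ↔ ∀ w ∈ S, P.Ω x v w = 0 := Iff.rfl

/-- The fibres of `W` are isomorphic to `ℂ ^ (2 n)`. -/
def fiberEquiv (_ : HiggsPair X n L W) (x : X) : W x ≃ₗ[ℂ] (Fin (2 * n) → ℂ) :=
  (trivializationAt (Fin (2 * n) → ℂ) W x).linearEquivAt (R := ℂ) x
    (FiberBundle.mem_baseSet_trivializationAt' x)

lemma finiteDimensional_fiber (P : HiggsPair X n L W) (x : X) : FiniteDimensional ℂ (W x) :=
  (P.fiberEquiv x).symm.finiteDimensional

lemma finrank_fiber (P : HiggsPair X n L W) (x : X) : Module.finrank ℂ (W x) = 2 * n := by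
  rw [(P.fiberEquiv x).finrank_eq, Module.finrank_fin_fun]

lemma perp_perp {x : X} (S : Submodule ℂ (W x)) : P.perp (P.perp S) = S := by
  have := P.finiteDimensional_fiber x
  rw [perp_eq_orthogonal, perp_eq_orthogonal]
  exact LinearMap.BilinForm.orthogonal_orthogonal (P.bilin_nondegenerate x) (P.bilin_isRefl x) S

lemma perp_anti {x : X} {S T : Submodule ℂ (W x)} (h : S ≤ T) : P.perp T ≤ P.perp S :=
  fun _ hv w hw => hv w (h hw)

lemma perp_injective (x : X) : Function.Injective (P.perp (x := x)) :=
  Function.LeftInverse.injective P.perp_perp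

lemma perp_bot (x : X) : P.perp (⊥ : Submodule ℂ (W x)) = ⊤ := by
  rw [eq_top_iff]
  rintro v - w hw
  simp [(Submodule.mem_bot ℂ).1 hw]

lemma perp_top (x : X) : P.perp (⊤ : Submodule ℂ (W x)) = ⊥ := by
  rw [← P.perp_bot x, perp_perp]

lemma perp_sup {x : X} (S T : Submodule ℂ (W x)) : P.perp (S ⊔ T) = P.perp S ⊓ P.perp T := by
  refine le_antisymm (le_inf (P.perp_anti le_sup_left) (P.perp_anti le_sup_right)) ?_
  rintro v ⟨hS, hT⟩ w hw
  obtain ⟨a, ha, b, hb, rfl⟩ := Submodule.mem_sup.1 hw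
  simp [hS a ha, hT b hb]

lemma perp_inf {x : X} (S T : Submodule ℂ (W x)) : P.perp (S ⊓ T) = P.perp S ⊔ P.perp T := by
  apply P.perp_injective
  rw [perp_sup, perp_perp, perp_perp, perp_perp]

lemma isCompl_perp {x : X} {S T : Submodule ℂ (W x)} (h : IsCompl S T) :
    IsCompl (P.perp S) (P.perp T) := by
  rw [isCompl_iff, disjoint_iff, codisjoint_iff, ← perp_sup, ← perp_inf, h.sup_eq_top, h.inf_eq_bot,
    perp_top, perp_bot]
  exact ⟨rfl, rfl⟩

/-- `Φ` is skew for `Ω`, so it can be moved to the argument in `S`, where it stays in `S`. -/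
lemma perp_invariant {x : X} {S : Submodule ℂ (W x)} {ξ : L x →L[ℂ] ℂ}
    (h : ∀ v ∈ S, P.Φ x ξ v ∈ S) : ∀ v ∈ P.perp S, P.Φ x ξ v ∈ P.perp S := by
  intro v hv w hw
  have := P.symplectic x ξ v w
  rwa [hv _ (h w hw), add_zero] at this

end Fibers

end HiggsPair

namespace HiggsPair

/-! ### Symplectic dual bases. -/

section DualFamilies

variable {X : Type*} [TopologicalSpace X] [ChartedSpace ℂ X]
  {n : ℕ}
  {L : X → Type*} [TopologicalSpace (TotalSpace ℂ L)]
  [∀ x, AddCommGroup (L x)] [∀ x, Module ℂ (L x)] [∀ x, TopologicalSpace (L x)]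
  [∀ x, IsTopologicalAddGroup (L x)] [∀ x, ContinuousSMul ℂ (L x)]
  [FiberBundle ℂ L] [VectorBundle ℂ ℂ L]
  {W : X → Type*} [TopologicalSpace (TotalSpace (Fin (2 * n) → ℂ) W)]
  [∀ x, AddCommGroup (W x)] [∀ x, Module ℂ (W x)] [∀ x, TopologicalSpace (W x)]
  [∀ x, IsTopologicalAddGroup (W x)] [∀ x, ContinuousSMul ℂ (W x)]
  [FiberBundle (Fin (2 * n) → ℂ) W] [VectorBundle ℂ (Fin (2 * n) → ℂ) W]
  (P : HiggsPair X n L W)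
  {ι κ : Type*} [Fintype ι] [DecidableEq ι] [Fintype κ] [DecidableEq κ]

/-- The matrix of the symplectic form in a family of vectors. -/
def omegaMatrix {x : X} (v : ι → W x) : Matrix ι ι ℂ := Matrix.of fun i j => P.Ω x (v i) (v j)

/-- The family which is dual to `v` for the symplectic form. -/
def dualFamily {x : X} (v : ι → W x) (i : ι) : W x := ∑ j, (P.omegaMatrix v)⁻¹ i j • v j

lemma linearIndependent_of_det_ne_zero {x : X} {v : ι → W x} (h : (P.omegaMatrix v).det ≠ 0) :
    LinearIndependent ℂ v := by
  rw [Fintype.linearIndependent_iff]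
  intro g hg
  refine congrFun (Matrix.eq_zero_of_vecMul_eq_zero h (funext fun j => ?_))
  have := congrArg (fun w => P.Ω x w (v j)) hg
  simpa [Matrix.vecMul, dotProduct, omegaMatrix, sum_apply] using this

lemma det_ne_zero_of_basis {x : X} {v : ι → W x} (hv : LinearIndependent ℂ v)
    (hs : Submodule.span ℂ (range v) = ⊤) : (P.omegaMatrix v).det ≠ 0 := by
  have h := (LinearMap.BilinForm.nondegenerate_iff_det_ne_zero
    (Module.Basis.mk hv hs.ge)).1 (P.bilin_nondegenerate x)
  convert h
  ext i j
  simp [omegaMatrix, LinearMap.BilinForm.toMatrix_apply]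

lemma span_eq_top_of_det_ne_zero {x : X} {v : ι → W x} (h : (P.omegaMatrix v).det ≠ 0)
    (hc : Fintype.card ι = 2 * n) : Submodule.span ℂ (range v) = ⊤ := by
  have := P.finiteDimensional_fiber x
  exact (P.linearIndependent_of_det_ne_zero h).span_eq_top_of_card_eq_finrank'
    (hc.trans (P.finrank_fiber x).symm)

lemma Ω_dualFamily {x : X} {v : ι → W x} (h : (P.omegaMatrix v).det ≠ 0) (i k : ι) :
    P.Ω x (P.dualFamily v i) (v k) = (1 : Matrix ι ι ℂ) i k := by
  rw [← Matrix.nonsing_inv_mul _ (Ne.isUnit h)]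
  simp [dualFamily, Matrix.mul_apply, omegaMatrix, sum_apply]

lemma eq_zero_of_forall_Ω_eq_zero {x : X} {v : ι → W x}
    (hs : Submodule.span ℂ (range v) = ⊤) {u : W x} (hu : ∀ i, P.Ω x u (v i) = 0) : u = 0 := by
  have h : ⊤ ≤ LinearMap.ker (P.Ω x u : W x →ₗ[ℂ] ℂ) := by
    rw [← hs, Submodule.span_le]
    rintro _ ⟨i, rfl⟩
    exact hu i
  exact P.nondegenerate x u fun w => h (Submodule.mem_top : w ∈ ⊤)

lemma eq_sum_dualFamily {x : X} {v : ι → W x} (h : (P.omegaMatrix v).det ≠ 0)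
    (hs : Submodule.span ℂ (range v) = ⊤) (u : W x) :
    u = ∑ i, P.Ω x u (v i) • P.dualFamily v i := by
  rw [← sub_eq_zero]
  refine P.eq_zero_of_forall_Ω_eq_zero hs fun k => ?_
  simp [sum_apply, P.Ω_dualFamily h, Matrix.one_apply]

lemma linearIndependent_dualFamily {x : X} {v : ι → W x} (h : (P.omegaMatrix v).det ≠ 0) :
    LinearIndependent ℂ (P.dualFamily v) := by
  rw [Fintype.linearIndependent_iff]
  intro g hg k
  have := congrArg (fun w => P.Ω x w (v k)) hg
  simpa [sum_apply, P.Ω_dualFamily h, Matrix.one_apply] using this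

/-- The coordinates of `u` in the dual family are the `Ω(u, v i)`, and perpendicularity to the first
vectors kills the first of them. This yields holomorphic frames of perpendiculars, the dual family
being given by an inverse matrix. -/
lemma span_dualFamily_inr {x : X} {v : ι ⊕ κ → W x} (h : (P.omegaMatrix v).det ≠ 0)
    (hs : Submodule.span ℂ (range v) = ⊤) :
    Submodule.span ℂ (range fun j => P.dualFamily v (Sum.inr j)) =
      P.perp (Submodule.span ℂ (range fun i => v (Sum.inl i))) := by
  refine le_antisymm (Submodule.span_le.2 ?_) fun u hu => ?_
  · rintro _ ⟨j, rfl⟩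
    have hle : Submodule.span ℂ (range fun i => v (Sum.inl i)) ≤
        LinearMap.ker (P.Ω x (P.dualFamily v (Sum.inr j)) : W x →ₗ[ℂ] ℂ) := by
      rw [Submodule.span_le]
      rintro _ ⟨i, rfl⟩
      simp [P.Ω_dualFamily h]
    exact fun w hw => hle hw
  · rw [P.eq_sum_dualFamily h hs u]
    refine Submodule.sum_mem _ fun i _ => ?_
    rcases i with i | j
    · rw [hu _ (Submodule.subset_span ⟨i, rfl⟩), zero_smul]
      exact Submodule.zero_mem _
    · exact Submodule.smul_mem _ _ (Submodule.subset_span ⟨j, rfl⟩)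

end DualFamilies

end HiggsPair

/-! ## Completion of frames -/

section HolSections

variable {X : Type*} [TopologicalSpace X] [ChartedSpace ℂ X]
  {F : Type*} [NormedAddCommGroup F] [NormedSpace ℂ F] [FiniteDimensional ℂ F]
  {W : X → Type*} [TopologicalSpace (TotalSpace F W)]
  [∀ x, AddCommGroup (W x)] [∀ x, Module ℂ (W x)] [∀ x, TopologicalSpace (W x)]
  [FiberBundle F W] [VectorBundle ℂ F W]

lemma IsHolSection.sum_smul {ι : Type*} [Fintype ι] {U : Set X} {s : ι → ∀ x, W x}
    {c : ι → X → ℂ} (hc : ∀ i, ContMDiffOn 𝓘(ℂ) 𝓘(ℂ) ω (c i) U)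
    (hs : ∀ i, IsHolSection F U (s i)) : IsHolSection F U fun x => ∑ i, c i x • s i x :=
  ContMDiffOn.sum_section fun i _ => (hc i).smul_section (hs i)

variable (F) in
-- Prolong `v` with constant coefficients in the frame of a trivialization.
lemma exists_isHolSection_eq [ContMDiffVectorBundle ω F W 𝓘(ℂ)] {x₀ : X} (v : W x₀) :
    ∃ s : ∀ x, W x, IsHolSection F (trivializationAt F W x₀).baseSet s ∧ s x₀ = v := by
  let b := Module.finBasis ℂ F
  let e := trivializationAt F W x₀
  have hx : x₀ ∈ e.baseSet := FiberBundle.mem_baseSet_trivializationAt' x₀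
  refine ⟨fun x => ∑ i, (e.basisAt b hx).repr v i • e.localFrame b i x,
    IsHolSection.sum_smul (fun i => contMDiffOn_const)
      fun i => e.contMDiffOn_localFrame_baseSet ω b i, ?_⟩
  simp only [e.localFrame_apply_of_mem_baseSet b hx]
  exact (e.basisAt b hx).sum_repr v

end HolSections

namespace HiggsPair

section Completions

variable {X : Type*} [TopologicalSpace X] [ChartedSpace ℂ X]
  {n : ℕ}
  {L : X → Type*} [TopologicalSpace (TotalSpace ℂ L)]
  [∀ x, AddCommGroup (L x)] [∀ x, Module ℂ (L x)] [∀ x, TopologicalSpace (L x)]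
  [∀ x, IsTopologicalAddGroup (L x)] [∀ x, ContinuousSMul ℂ (L x)]
  [FiberBundle ℂ L] [VectorBundle ℂ ℂ L]
  {W : X → Type*} [TopologicalSpace (TotalSpace (Fin (2 * n) → ℂ) W)]
  [∀ x, AddCommGroup (W x)] [∀ x, Module ℂ (W x)] [∀ x, TopologicalSpace (W x)]
  [∀ x, IsTopologicalAddGroup (W x)] [∀ x, ContinuousSMul ℂ (W x)]
  [FiberBundle (Fin (2 * n) → ℂ) W] [VectorBundle ℂ (Fin (2 * n) → ℂ) W]
  (P : HiggsPair X n L W)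

lemma contMDiffOn_Ω {U : Set X} {s t : ∀ x, W x} (hs : IsHolSection (Fin (2 * n) → ℂ) U s)
    (ht : IsHolSection (Fin (2 * n) → ℂ) U t) :
    ContMDiffOn 𝓘(ℂ) 𝓘(ℂ) ω (fun x => P.Ω x (s x) (t x)) U := by
  have h := ContMDiffOn.clm_bundle_apply₂ (b := id) (E₃ := Trivial X ℂ) (F₃ := ℂ)
    (ψ := P.Ω) P.hol_Ω.contMDiffOn hs ht
  intro x hx
  exact Bundle.contMDiffWithinAt_section.1 (h x hx)

/-- A completion of a holomorphic frame of a subbundle to a holomorphic frame of `W`. -/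
structure Completion {S : ∀ x, Submodule ℂ (W x)} {x₀ : X}
    (e : HolFrame (Fin (2 * n) → ℂ) S x₀) where
  /-- the open set on which the completion is defined -/
  dom : Set X
  isOpen_dom : IsOpen dom
  mem_dom : x₀ ∈ dom
  dom_subset : dom ⊆ e.dom
  /-- the number of sections added to the frame -/
  corank : ℕ
  rank_add_corank : e.rank + corank = 2 * n
  /-- the sections added to the frame -/
  sec : Fin corank → ∀ x, W x
  hol : ∀ i, IsHolSection (Fin (2 * n) → ℂ) dom (sec i)
  det_ne_zero : ∀ x ∈ dom,
    (P.omegaMatrix (Sum.elim (fun i => e.sec i x) fun i => sec i x)).det ≠ 0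

variable {P} in
/-- The full frame of a completion. -/
def Completion.full {S : ∀ x, Submodule ℂ (W x)} {x₀ : X}
    {e : HolFrame (Fin (2 * n) → ℂ) S x₀} (c : P.Completion e) (x : X) :
    Fin e.rank ⊕ Fin c.corank → W x :=
  Sum.elim (fun i => e.sec i x) fun i => c.sec i x

/-- Prolong a basis of a complement of `S x₀` to local sections. Being a frame of `W` is the open
condition that the determinant of `Ω` on the family be nonzero. -/
lemma exists_completion [ContMDiffVectorBundle ω (Fin (2 * n) → ℂ) W 𝓘(ℂ)]
    {S : ∀ x, Submodule ℂ (W x)} {x₀ : X}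
    (e : HolFrame (Fin (2 * n) → ℂ) S x₀) : Nonempty (P.Completion e) := by
  have := P.finiteDimensional_fiber x₀
  obtain ⟨T, hT⟩ := Submodule.exists_isCompl (S x₀)
  let b := Module.finBasis ℂ T
  choose s hs hsx using fun i => exists_isHolSection_eq (Fin (2 * n) → ℂ) (b i : W x₀)
  set V := e.dom ∩ (trivializationAt (Fin (2 * n) → ℂ) W x₀).baseSet with hV
  have hVo : IsOpen V := e.isOpen_dom.inter (trivializationAt _ W x₀).open_baseSet
  have hxV : x₀ ∈ V := ⟨e.mem_dom, FiberBundle.mem_baseSet_trivializationAt' x₀⟩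
  have hsV : ∀ i, IsHolSection (Fin (2 * n) → ℂ) V (s i) := fun i => (hs i).mono inter_subset_right
  have heV : ∀ i, IsHolSection (Fin (2 * n) → ℂ) V (e.sec i) :=
    fun i => (e.hol i).mono inter_subset_left
  let full : ∀ x, Fin e.rank ⊕ Fin (Module.finrank ℂ T) → W x := fun x =>
    Sum.elim (fun i => e.sec i x) fun i => s i x
  have hfull : ∀ i, IsHolSection (Fin (2 * n) → ℂ) V (fun x => full x i) := by
    rintro (i | i)
    exacts [heV i, hsV i]
  have hd : ContinuousOn (fun x => (P.omegaMatrix (full x)).det) V :=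
    (contMDiffOn_det fun i j => P.contMDiffOn_Ω (hfull i) (hfull j)).continuousOn
  have hspan : Submodule.span ℂ (range fun i => s i x₀) = T := by
    have : (fun i => s i x₀) = T.subtype ∘ b := by
      ext i
      simp [hsx]
    rw [this, range_comp, Submodule.span_image, b.span_eq, Submodule.map_subtype_top]
  have hlin : LinearIndependent ℂ (full x₀) := by
    refine LinearIndependent.sum_type (e.linearIndependent x₀ e.mem_dom) ?_ ?_
    · have : (fun i => s i x₀) = T.subtype ∘ b := by
        ext i
        simp [hsx]
      rw [this]
      exact b.linearIndependent.map' _ T.ker_subtype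
    · rw [e.span_eq x₀ e.mem_dom, hspan]
      exact hT.disjoint
  have htop : Submodule.span ℂ (range (full x₀)) = ⊤ := by
    rw [Sum.elim_range, Submodule.span_union, hspan, e.span_eq x₀ e.mem_dom, hT.sup_eq_top]
  refine ⟨⟨V ∩ {x | (P.omegaMatrix (full x)).det ≠ 0}, hd.isOpen_inter_preimage hVo isOpen_ne,
    ⟨hxV, P.det_ne_zero_of_basis hlin htop⟩, fun x hx => hx.1.1, _, ?_, s,
    fun i => (hsV i).mono inter_subset_left, fun x hx => hx.2⟩⟩
  have := Module.finrank_eq_card_basis (Module.Basis.mk hlin htop.ge)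
  simpa [P.finrank_fiber] using this.symm

namespace Completion

variable {P} {S : ∀ x, Submodule ℂ (W x)} {x₀ : X}
  {e : HolFrame (Fin (2 * n) → ℂ) S x₀} (c : P.Completion e)

lemma det_full_ne_zero {x : X} (hx : x ∈ c.dom) : (P.omegaMatrix (c.full x)).det ≠ 0 :=
  c.det_ne_zero x hx

lemma span_full {x : X} (hx : x ∈ c.dom) : Submodule.span ℂ (range (c.full x)) = ⊤ :=
  P.span_eq_top_of_det_ne_zero (c.det_full_ne_zero hx) (by simp [c.rank_add_corank])

lemma hol_full (i : Fin e.rank ⊕ Fin c.corank) :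
    IsHolSection (Fin (2 * n) → ℂ) c.dom fun x => c.full x i := by
  rcases i with i | i
  exacts [(e.hol i).mono c.dom_subset, c.hol i]

lemma contMDiffOn_det_full :
    ContMDiffOn 𝓘(ℂ) 𝓘(ℂ) ω (fun x => (P.omegaMatrix (c.full x)).det) c.dom :=
  contMDiffOn_det fun i j => P.contMDiffOn_Ω (c.hol_full i) (c.hol_full j)

/-- The frame of the perpendicular defined by a completion: the last vectors of the dual of the
full frame. -/
def perpFrame : HolFrame (Fin (2 * n) → ℂ) (fun x => P.perp (S x)) x₀ where
  dom := c.dom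
  isOpen_dom := c.isOpen_dom
  mem_dom := c.mem_dom
  rank := c.corank
  sec j x := P.dualFamily (c.full x) (Sum.inr j)
  hol j := IsHolSection.sum_smul
    (fun k => contMDiffOn_matrix_inv (fun i j => P.contMDiffOn_Ω (c.hol_full i) (c.hol_full j))
      (fun x hx => c.det_full_ne_zero hx) _ k) c.hol_full
  linearIndependent x hx :=
    (P.linearIndependent_dualFamily (c.det_full_ne_zero hx)).comp _ Sum.inr_injective
  span_eq x hx := by
    rw [P.span_dualFamily_inr (c.det_full_ne_zero hx) (c.span_full hx)]
    exact congrArg P.perp (e.span_eq x (c.dom_subset hx))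

end Completion

/-- The perpendicular of a subbundle. -/
def perpBundle [ContMDiffVectorBundle ω (Fin (2 * n) → ℂ) W 𝓘(ℂ)]
    (S : HolSubbundle (Fin (2 * n) → ℂ) W) : HolSubbundle (Fin (2 * n) → ℂ) W where
  fiber x := P.perp (S.fiber x)
  exists_frame x := by
    obtain ⟨e⟩ := S.exists_frame x
    obtain ⟨c⟩ := P.exists_completion e
    exact ⟨c.perpFrame⟩

end Completions

end HiggsPair

/-! ## Operations on subbundles -/

namespace HolSubbundle

variable {X : Type*} [TopologicalSpace X] [ChartedSpace ℂ X]
  {F : Type*} [NormedAddCommGroup F] [NormedSpace ℂ F]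
  {W : X → Type*} [TopologicalSpace (TotalSpace F W)]
  [∀ x, AddCommGroup (W x)] [∀ x, Module ℂ (W x)] [∀ x, TopologicalSpace (W x)]
  [FiberBundle F W]

lemma ext_fiber {S T : HolSubbundle F W} (h : ∀ x, S.fiber x = T.fiber x) : S = T := by
  cases S
  cases T
  congr
  exact funext h

variable (F W) in
/-- The zero subbundle. -/
def zero : HolSubbundle F W where
  fiber _ := ⊥
  exists_frame x := ⟨
    { dom := univ
      isOpen_dom := isOpen_univ
      mem_dom := mem_univ x
      rank := 0
      sec := fun i => i.elim0
      hol := fun i => i.elim0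
      linearIndependent := fun _ _ => linearIndependent_empty_type
      span_eq := fun _ _ => by simp }⟩

/-- The sum of two subbundles with zero intersection. -/
def sup (S T : HolSubbundle F W) (h : ∀ x, Disjoint (S.fiber x) (T.fiber x)) :
    HolSubbundle F W where
  fiber x := S.fiber x ⊔ T.fiber x
  exists_frame x := by
    obtain ⟨e⟩ := S.exists_frame x
    obtain ⟨f⟩ := T.exists_frame x
    refine ⟨
      { dom := e.dom ∩ f.dom
        isOpen_dom := e.isOpen_dom.inter f.isOpen_dom
        mem_dom := ⟨e.mem_dom, f.mem_dom⟩
        rank := e.rank + f.rank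
        sec := fun i => Sum.elim e.sec f.sec (finSumFinEquiv.symm i)
        hol := fun i => ?_
        linearIndependent := fun y hy => ?_
        span_eq := fun y hy => ?_ }⟩
    · rcases finSumFinEquiv.symm i with i | i
      exacts [(e.hol i).mono inter_subset_left, (f.hol i).mono inter_subset_right]
    · have hl := (e.linearIndependent y hy.1).sum_type (f.linearIndependent y hy.2)
        (by rw [e.span_eq y hy.1, f.span_eq y hy.2]; exact h y)
      have heq : (fun i => Sum.elim e.sec f.sec (finSumFinEquiv.symm i) y) =
          Sum.elim (fun i => e.sec i y) (fun i => f.sec i y) ∘ finSumFinEquiv.symm := by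
        ext i
        rcases h : finSumFinEquiv.symm i with j | j <;> simp [h]
      rw [heq]
      exact hl.comp _ finSumFinEquiv.symm.injective
    · rw [← e.span_eq y hy.1, ← f.span_eq y hy.2, ← Submodule.span_union, ← Sum.elim_range,
        ← finSumFinEquiv.symm.surjective.range_comp]
      congr 2
      ext i
      rcases h : finSumFinEquiv.symm i with j | j <;> simp [h]

lemma rank_eq_finrank {S : ∀ x, Submodule ℂ (W x)} {x₀ : X} (e : HolFrame F S x₀) {x : X}
    (hx : x ∈ e.dom) : e.rank = Module.finrank ℂ (S x) := by
  rw [← e.span_eq x hx, finrank_span_eq_card (e.linearIndependent x hx), Fintype.card_fin]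

lemma finrank_fiber_eq [PreconnectedSpace X] (S : HolSubbundle F W) (x y : X) :
    Module.finrank ℂ (S.fiber x) = Module.finrank ℂ (S.fiber y) := by
  have h : IsLocallyConstant fun x => Module.finrank ℂ (S.fiber x) := by
    rw [IsLocallyConstant.iff_eventually_eq]
    intro x
    obtain ⟨e⟩ := S.exists_frame x
    filter_upwards [e.isOpen_dom.mem_nhds e.mem_dom] with y hy
    rw [← rank_eq_finrank e hy, ← rank_eq_finrank e e.mem_dom]
  exact h.apply_eq_of_preconnectedSpace x y

end HolSubbundle

namespace HiggsPair

variable {X : Type*} [TopologicalSpace X] [ChartedSpace ℂ X]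
  {n : ℕ}
  {L : X → Type*} [TopologicalSpace (TotalSpace ℂ L)]
  [∀ x, AddCommGroup (L x)] [∀ x, Module ℂ (L x)] [∀ x, TopologicalSpace (L x)]
  [∀ x, IsTopologicalAddGroup (L x)] [∀ x, ContinuousSMul ℂ (L x)]
  [FiberBundle ℂ L] [VectorBundle ℂ ℂ L]
  {W : X → Type*} [TopologicalSpace (TotalSpace (Fin (2 * n) → ℂ) W)]
  [∀ x, AddCommGroup (W x)] [∀ x, Module ℂ (W x)] [∀ x, TopologicalSpace (W x)]
  [∀ x, IsTopologicalAddGroup (W x)] [∀ x, ContinuousSMul ℂ (W x)]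
  [FiberBundle (Fin (2 * n) → ℂ) W] [VectorBundle ℂ (Fin (2 * n) → ℂ) W]
  (P : HiggsPair X n L W)
  [ContMDiffVectorBundle ω (Fin (2 * n) → ℂ) W 𝓘(ℂ)]

lemma perpBundle_perpBundle (S : HolSubbundle (Fin (2 * n) → ℂ) W) :
    P.perpBundle (P.perpBundle S) = S :=
  HolSubbundle.ext_fiber fun _ => P.perp_perp _

/-- The intersection of two subbundles whose sum is the whole bundle. -/
def infBundle (S T : HolSubbundle (Fin (2 * n) → ℂ) W)
    (h : ∀ x, Codisjoint (S.fiber x) (T.fiber x)) : HolSubbundle (Fin (2 * n) → ℂ) W :=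
  -- The perpendiculars have zero intersection, so their frames can be concatenated.
  P.perpBundle ((P.perpBundle S).sup (P.perpBundle T) fun x => by
    rw [disjoint_iff]
    exact (P.perp_sup _ _).symm.trans ((congrArg P.perp (h x).eq_top).trans (P.perp_top x)))

lemma infBundle_fiber (S T : HolSubbundle (Fin (2 * n) → ℂ) W)
    (h : ∀ x, Codisjoint (S.fiber x) (T.fiber x)) (x : X) :
    (P.infBundle S T h).fiber x = S.fiber x ⊓ T.fiber x := by
  change P.perp (P.perp (S.fiber x) ⊔ P.perp (T.fiber x)) = _
  rw [P.perp_sup, P.perp_perp, P.perp_perp]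

end HiggsPair

/-! ## Gram determinants -/

section Gram

variable {V : Type*} [AddCommGroup V] [Module ℂ V] {ι : Type*} [Fintype ι] [DecidableEq ι]

/-- The Gram matrix of a family of vectors. -/
def gramMatrix (c : InnerProductSpace.Core ℂ V) (v : ι → V) : Matrix ι ι ℂ :=
  Matrix.of fun i j => c.inner (v i) (v j)

open scoped ComplexOrder in
lemma gramMatrix_det_re_pos (c : InnerProductSpace.Core ℂ V) {v : ι → V}
    (hv : LinearIndependent ℂ v) : 0 < (gramMatrix c v).det.re := by
  let := c.toNormedAddCommGroup
  let : InnerProductSpace ℂ V := .ofCore c.toCore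
  have h : 0 < (Matrix.gram ℂ v).det := (Matrix.posDef_gram_of_linearIndependent hv).det_pos
  exact (Complex.lt_def.1 h).1

lemma gramMatrix_sum_smul (c : InnerProductSpace.Core ℂ V) (v : ι → V) (A : Matrix ι ι ℂ) :
    gramMatrix c (fun j => ∑ i, A i j • v i) = A.conjTranspose * gramMatrix c v * A := by
  let := c.toNormedAddCommGroup
  let : InnerProductSpace ℂ V := .ofCore c.toCore
  ext j k
  change inner ℂ (∑ i, A i j • v i) (∑ i, A i k • v i) = _
  have h : ∀ a b, gramMatrix c v a b = inner ℂ (v a) (v b) := fun _ _ => rfl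
  simp only [sum_inner, inner_sum, inner_smul_left, inner_smul_right, Matrix.mul_apply,
    Matrix.conjTranspose_apply, h, Finset.sum_mul, Finset.mul_sum]
  refine Finset.sum_congr rfl fun a _ => Finset.sum_congr rfl fun b _ => ?_
  simp only [RCLike.star_def]
  ring

lemma log_gramMatrix_sum_smul (c : InnerProductSpace.Core ℂ V) {v : ι → V}
    (hv : LinearIndependent ℂ v) {A : Matrix ι ι ℂ} (hA : A.det ≠ 0) :
    Real.log (gramMatrix c (fun j => ∑ i, A i j • v i)).det.re =
      2 * Real.log ‖A.det‖ + Real.log (gramMatrix c v).det.re := by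
  have h : (gramMatrix c (fun j => ∑ i, A i j • v i)).det.re =
      ‖A.det‖ ^ 2 * (gramMatrix c v).det.re := by
    rw [gramMatrix_sum_smul, Matrix.det_mul, Matrix.det_mul, Matrix.det_conjTranspose,
      mul_right_comm, RCLike.star_def, Complex.conj_mul', ← Complex.ofReal_pow,
      Complex.re_ofReal_mul]
  rw [h, Real.log_mul (by simpa using hA) (gramMatrix_det_re_pos c hv).ne', Real.log_pow]
  norm_num

end Gram

/-! ## Real smooth functions on a complex manifold -/

section Real

variable {X : Type*} [TopologicalSpace X] [ChartedSpace ℂ X]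

variable (X) in
lemma isManifold_real [IsManifold 𝓘(ℂ) ω X] : IsManifold 𝓘(ℝ, ℂ) ∞ X := by
  refine isManifold_of_contDiffOn _ _ _ fun e e' he he' => ?_
  have h := HasGroupoid.compatible (G := contDiffGroupoid ω 𝓘(ℂ)) he he'
  rw [contDiffGroupoid, mem_groupoid_of_pregroupoid] at h
  exact (ContDiffOn.restrict_scalars ℝ h.1).of_le le_top

lemma contMDiffOn_real_of_complex {F : Type*} [NormedAddCommGroup F] [NormedSpace ℂ F] [NormedSpace ℝ F]
    [IsScalarTower ℝ ℂ F] {f : X → F} {U : Set X} (hf : ContMDiffOn 𝓘(ℂ) 𝓘(ℂ, F) ω f U) :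
    ContMDiffOn 𝓘(ℝ, ℂ) 𝓘(ℝ, F) ∞ f U := by
  intro x hx
  have h := contMDiffWithinAt_iff.1 (hf x hx)
  exact contMDiffWithinAt_iff.2 ⟨h.1, (h.2.restrict_scalars ℝ).of_le le_top⟩

end Real

/-! ### Gram determinants of frames and conformal changes of metric. -/

section Metrics

variable {X : Type*} [TopologicalSpace X] [ChartedSpace ℂ X]
  {F : Type*} [NormedAddCommGroup F] [NormedSpace ℂ F]
  {W : X → Type*} [TopologicalSpace (TotalSpace F W)]
  [∀ x, AddCommGroup (W x)] [∀ x, Module ℂ (W x)] [∀ x, TopologicalSpace (W x)]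
  [FiberBundle F W]

lemma logGram_eq (h : HermitianMetric F W) {S : ∀ x, Submodule ℂ (W x)} {x₀ : X}
    (e : HolFrame F S x₀) (x : X) :
    logGram h e x = Real.log (gramMatrix (h.core x) fun i => e.sec i x).det.re := rfl

lemma contMDiffOn_logGram (h : HermitianMetric F W) {S : ∀ x, Submodule ℂ (W x)} {x₀ : X}
    (e : HolFrame F S x₀) : ContMDiffOn 𝓘(ℝ, ℂ) 𝓘(ℝ) ∞ (logGram h e) e.dom := by
  have hd : ContMDiffOn 𝓘(ℝ, ℂ) 𝓘(ℝ, ℂ) ∞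
      (fun x => (gramMatrix (h.core x) fun i => e.sec i x).det) e.dom :=
    contMDiffOn_det fun i j => h.smooth _ _ _ e.isOpen_dom (e.hol i) (e.hol j)
  intro x hx
  have hpos := gramMatrix_det_re_pos (h.core x) (e.linearIndependent x hx)
  have h1 := Complex.reCLM.contDiff.contMDiff.contMDiffAt.comp_contMDiffWithinAt x (hd x hx)
  exact ContMDiffAt.comp_contMDiffWithinAt (g := Real.log) x
    (Real.contDiffAt_log.2 hpos.ne').contMDiffAt h1

/-- The metric `exp p • h`. -/
def HermitianMetric.conformal (h : HermitianMetric F W) (p : X → ℝ)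
    (hp : ContMDiff 𝓘(ℝ, ℂ) 𝓘(ℝ) ∞ p) : HermitianMetric F W where
  core x :=
    { inner := fun v w => (Real.exp (p x) : ℂ) * (h.core x).inner v w
      conj_inner_symm := fun v w => by
        rw [map_mul, (h.core x).conj_inner_symm, Complex.conj_ofReal]
      re_inner_nonneg := fun v => by
        have h1 := (h.core x).re_inner_nonneg v
        have h2 := Real.exp_pos (p x)
        simp only [RCLike.re_eq_complex_re, Complex.re_ofReal_mul] at h1 ⊢
        positivity
      add_left := fun u v w => by rw [(h.core x).add_left, mul_add]
      smul_left := fun v w r => by rw [(h.core x).smul_left]; ring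
      definite := fun v hv => (h.core x).definite v <|
        (mul_eq_zero.1 hv).resolve_left (Complex.ofReal_ne_zero.2 (Real.exp_pos _).ne') }
  smooth U s t hU hs ht := by
    have h1 : ContMDiff 𝓘(ℝ, ℂ) 𝓘(ℝ, ℂ) ∞ fun x => (Real.exp (p x) : ℂ) :=
      (Complex.ofRealCLM.contDiff.comp Real.contDiff_exp).contMDiff.comp hp
    exact (contDiff_mul (𝕜 := ℝ) (𝔸 := ℂ)).contMDiff.comp_contMDiffOn
      (h1.contMDiffOn.prodMk_space (h.smooth U s t hU hs ht))

lemma logGram_conformal (h : HermitianMetric F W) {p : X → ℝ}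
    (hp : ContMDiff 𝓘(ℝ, ℂ) 𝓘(ℝ) ∞ p) {S : ∀ x, Submodule ℂ (W x)} {x₀ : X}
    (e : HolFrame F S x₀) {x : X} (hx : x ∈ e.dom) :
    logGram (h.conformal p hp) e x = e.rank * p x + logGram h e x := by
  have h1 : (gramMatrix ((h.conformal p hp).core x) fun i => e.sec i x) =
      (Real.exp (p x) : ℂ) • gramMatrix (h.core x) fun i => e.sec i x := rfl
  rw [logGram_eq, logGram_eq, h1, Matrix.det_smul, Fintype.card_fin, ← Complex.ofReal_pow,
    Complex.re_ofReal_mul, Real.log_mul (pow_pos (Real.exp_pos _) _).ne'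
      (gramMatrix_det_re_pos _ (e.linearIndependent x hx)).ne', Real.log_pow, Real.log_exp]

end Metrics

/-! ### Existence of Hermitian metrics. -/

section Existence

variable {X : Type*} [TopologicalSpace X] [ChartedSpace ℂ X] {m : ℕ}
  {W : X → Type*} [TopologicalSpace (TotalSpace (Fin m → ℂ) W)]
  [∀ x, AddCommGroup (W x)] [∀ x, Module ℂ (W x)] [∀ x, TopologicalSpace (W x)]
  [FiberBundle (Fin m → ℂ) W] [VectorBundle ℂ (Fin m → ℂ) W]
  [ContMDiffVectorBundle ω (Fin m → ℂ) W 𝓘(ℂ)]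

variable (m W) in
lemma exists_hermitianMetric [T2Space X] [SigmaCompactSpace X] [IsManifold 𝓘(ℂ) ω X] :
    Nonempty (HermitianMetric (Fin m → ℂ) W) := by
  have := isManifold_real X
  let T := fun i : X => trivializationAt (Fin m → ℂ) W i
  obtain ⟨ρ, hρ⟩ := SmoothPartitionOfUnity.exists_isSubordinate 𝓘(ℝ, ℂ) isClosed_univ
    (fun i => (T i).baseSet) (fun i => (T i).open_baseSet) (fun x _ => mem_iUnion.2
      ⟨x, FiberBundle.mem_baseSet_trivializationAt' x⟩)
  -- The standard inner product in the `i`-th trivialization. Off the base set `linearMapAt` is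
  -- zero, but `ρ i` vanishes there too.
  let φ : ∀ i x : X, W x → W x → ℂ := fun i x v w =>
    star ((T i).linearMapAt ℂ x v) ⬝ᵥ (T i).linearMapAt ℂ x w
  have hφ : ∀ i x v, φ i x v v = ((∑ k, ‖(T i).linearMapAt ℂ x v k‖ ^ 2 : ℝ) : ℂ) := by
    intro i x v
    simp [φ, dotProduct, Complex.conj_mul']
  refine ⟨⟨fun x =>
    { inner := fun v w => ∑ i ∈ ρ.finsupport x, ρ i x • φ i x v w
      conj_inner_symm := fun v w => ?_
      re_inner_nonneg := fun v => ?_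
      add_left := fun u v w => ?_
      smul_left := fun v w r => ?_
      definite := fun v hv => ?_ }, fun U s t hU hs ht => ?_⟩⟩
  · simp [φ, dotProduct, mul_comm]
  · simp only [hφ, Complex.real_smul, ← Complex.ofReal_mul, ← Complex.ofReal_sum]
    simp only [RCLike.re_eq_complex_re, Complex.ofReal_re]
    exact Finset.sum_nonneg fun i _ => mul_nonneg (ρ.nonneg i x)
      (Finset.sum_nonneg fun k _ => by positivity)
  · simp [φ, add_dotProduct, Finset.sum_add_distrib]
  · simp [φ, smul_dotProduct, Finset.mul_sum, mul_left_comm]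
  · change ∑ i ∈ ρ.finsupport x, ρ i x • φ i x v v = 0 at hv
    simp only [hφ, Complex.real_smul, ← Complex.ofReal_mul, ← Complex.ofReal_sum] at hv
    rw [Complex.ofReal_eq_zero, Finset.sum_eq_zero_iff_of_nonneg fun i _ =>
      mul_nonneg (ρ.nonneg i x) (Finset.sum_nonneg fun k _ => by positivity)] at hv
    -- Some weight is positive at `x`, and its term alone forces the coordinates of `v` to vanish.
    obtain ⟨i, hi⟩ := ρ.exists_pos_of_mem (mem_univ x)
    have hx : x ∈ (T i).baseSet := hρ i (subset_tsupport _ hi.ne')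
    have h0 := (mul_eq_zero.1 (hv i ((ρ.mem_finsupport x).2 hi.ne'))).resolve_left hi.ne'
    rw [Finset.sum_eq_zero_iff_of_nonneg fun k _ => by positivity] at h0
    have h1 : (T i).linearMapAt ℂ x v = 0 := funext fun k => by simpa using h0 k (Finset.mem_univ k)
    rw [(T i).linearMapAt_def_of_mem hx] at h1
    exact ((T i).linearEquivAt (R := ℂ) x hx).map_eq_zero_iff.1 h1
  · intro x hx
    refine ContMDiffAt.contMDiffWithinAt ?_
    change ContMDiffAt 𝓘(ℝ, ℂ) 𝓘(ℝ, ℂ) ∞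
      (fun x => ∑ i ∈ ρ.finsupport x, ρ i x • φ i x (s x) (t x)) x
    simp only [fun x => ρ.sum_finsupport_smul_eq_finsum x fun i x => φ i x (s x) (t x)]
    refine ρ.contMDiffAt_finsum fun i hi => ?_
    have hxi : x ∈ (T i).baseSet := hρ i hi
    have key : ∀ s : ∀ x, W x, IsHolSection (Fin m → ℂ) U s → ∀ k, ContMDiffAt 𝓘(ℝ, ℂ) 𝓘(ℝ, ℂ) ∞
        (fun x => (T i).linearMapAt ℂ x (s x) k) x := by
      intro s hs k
      have h1 := ((T i).contMDiffOn_section_iff (hU.inter (T i).open_baseSet)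
        inter_subset_right).1 (ContMDiffOn.mono hs inter_subset_left)
      have h2 := (contMDiffOn_real_of_complex h1).contMDiffAt
        ((hU.inter (T i).open_baseSet).mem_nhds ⟨hx, hxi⟩)
      refine (contMDiffAt_pi_space.1 h2 k).congr_of_eventuallyEq ?_
      filter_upwards [(T i).open_baseSet.mem_nhds hxi] with y hy
      rw [(T i).linearMapAt_apply, if_pos hy]
    have : (fun x => φ i x (s x) (t x)) = fun x => ∑ k,
        starRingEnd ℂ ((T i).linearMapAt ℂ x (s x) k) * (T i).linearMapAt ℂ x (t x) k := rfl
    rw [this]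
    refine ContMDiffAt.sum fun k _ => ?_
    exact (contDiff_mul (𝕜 := ℝ) (𝔸 := ℂ)).contMDiff.contMDiffAt.comp x
      ((Complex.conjCLE.contDiff.contMDiff.contMDiffAt.comp x (key s hs k)).prodMk_space
        (key t ht k))

end Existence

/-! ## Duality for degrees -/

namespace HiggsPair

section VolumeRatio

variable {X : Type*} [TopologicalSpace X] [ChartedSpace ℂ X]
  {n : ℕ}
  {L : X → Type*} [TopologicalSpace (TotalSpace ℂ L)]
  [∀ x, AddCommGroup (L x)] [∀ x, Module ℂ (L x)] [∀ x, TopologicalSpace (L x)]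
  [∀ x, IsTopologicalAddGroup (L x)] [∀ x, ContinuousSMul ℂ (L x)]
  [FiberBundle ℂ L] [VectorBundle ℂ ℂ L]
  {W : X → Type*} [TopologicalSpace (TotalSpace (Fin (2 * n) → ℂ) W)]
  [∀ x, AddCommGroup (W x)] [∀ x, Module ℂ (W x)] [∀ x, TopologicalSpace (W x)]
  [∀ x, IsTopologicalAddGroup (W x)] [∀ x, ContinuousSMul ℂ (W x)]
  [FiberBundle (Fin (2 * n) → ℂ) W] [VectorBundle ℂ (Fin (2 * n) → ℂ) W]
  (P : HiggsPair X n L W)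
  {ι κ : Type*} [Fintype ι] [DecidableEq ι] [Fintype κ] [DecidableEq κ]

/-- For a basis `v` of a fibre, the first vectors of which span `S`, this compares the volume of
`S` with that of its perpendicular. -/
def logVolumeRatio {x : X} (c : InnerProductSpace.Core ℂ (W x)) (v : ι ⊕ κ → W x) : ℝ :=
  Real.log (gramMatrix c fun j => P.dualFamily v (Sum.inr j)).det.re +
    Real.log ‖(P.omegaMatrix v).det‖ - Real.log (gramMatrix c fun i => v (Sum.inl i)).det.re

lemma omegaMatrix_sum_smul {x : X} (v : ι → W x) (A : Matrix ι ι ℂ) :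
    P.omegaMatrix (fun j => ∑ i, A i j • v i) = A.transpose * P.omegaMatrix v * A := by
  ext j k
  simp only [omegaMatrix, Matrix.of_apply, map_sum, map_smul, sum_apply, smul_apply, smul_eq_mul,
    Matrix.mul_apply, Matrix.transpose_apply, Finset.sum_mul, Finset.mul_sum]
  refine Finset.sum_congr rfl fun a _ => Finset.sum_congr rfl fun b _ => ?_
  ring

lemma eq_sum_Ω_dualFamily {x : X} {v : ι → W x} (h : (P.omegaMatrix v).det ≠ 0)
    (hs : Submodule.span ℂ (range v) = ⊤) (w : W x) :
    w = ∑ i, P.Ω x (P.dualFamily v i) w • v i := by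
  obtain ⟨a, rfl⟩ := (Submodule.mem_span_range_iff_exists_fun ℂ).1
    (hs ▸ Submodule.mem_top : w ∈ Submodule.span ℂ (range v))
  refine Finset.sum_congr rfl fun i _ => ?_
  simp [P.Ω_dualFamily h, Matrix.one_apply]

/-- The change of basis `A` from `v` to `v'` is block triangular, as the first vectors span the same
space, and the last dual vectors change by `Q`, the inverse transpose of `A₂₂`. The three terms of
the ratio change by `-2 log |det A₂₂|`, `2 log |det A₁₁| + 2 log |det A₂₂|` and `-2 log |det A₁₁|`,
which cancel. -/
lemma logVolumeRatio_eq {x : X} (c : InnerProductSpace.Core ℂ (W x)) {v v' : ι ⊕ κ → W x}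
    (h : (P.omegaMatrix v).det ≠ 0) (h' : (P.omegaMatrix v').det ≠ 0)
    (hs : Submodule.span ℂ (range v) = ⊤) (hs' : Submodule.span ℂ (range v') = ⊤)
    (hS : Submodule.span ℂ (range fun i => v (Sum.inl i)) =
      Submodule.span ℂ (range fun i => v' (Sum.inl i))) :
    P.logVolumeRatio c v = P.logVolumeRatio c v' := by
  have hperp : ∀ j, ∀ w ∈ Submodule.span ℂ (range fun i => v (Sum.inl i)),
      P.Ω x (P.dualFamily v (Sum.inr j)) w = 0 := fun j =>
    P.mem_perp.1 ((P.span_dualFamily_inr h hs).le (Submodule.subset_span (mem_range_self j)))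
  have hperp' : ∀ j, ∀ w ∈ Submodule.span ℂ (range fun i => v' (Sum.inl i)),
      P.Ω x (P.dualFamily v' (Sum.inr j)) w = 0 := fun j =>
    P.mem_perp.1 ((P.span_dualFamily_inr h' hs').le (Submodule.subset_span (mem_range_self j)))
  let A : Matrix (ι ⊕ κ) (ι ⊕ κ) ℂ := Matrix.of fun i j => P.Ω x (P.dualFamily v i) (v' j)
  have hA : ∀ j, v' j = ∑ i, A i j • v i := fun j => P.eq_sum_Ω_dualFamily h hs (v' j)
  have hA21 : A.toBlocks₂₁ = 0 := by
    ext j i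
    exact hperp j _ (hS ▸ Submodule.subset_span ⟨i, rfl⟩)
  let Q : Matrix κ κ ℂ := Matrix.of fun i j => P.Ω x (P.dualFamily v' (Sum.inr j)) (v (Sum.inr i))
  have hQ : ∀ j, P.dualFamily v' (Sum.inr j) = ∑ i, Q i j • P.dualFamily v (Sum.inr i) := by
    intro j
    have := P.eq_sum_dualFamily h hs (P.dualFamily v' (Sum.inr j))
    rw [Fintype.sum_sum_type, Finset.sum_eq_zero, zero_add] at this
    · exact this
    · intro i _
      rw [hperp' j _ (hS ▸ Submodule.subset_span ⟨i, rfl⟩), zero_smul]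
  have hdetA : A.det = A.toBlocks₁₁.det * A.toBlocks₂₂.det := by
    conv_lhs => rw [← A.fromBlocks_toBlocks, hA21, Matrix.det_fromBlocks_zero₂₁]
  have hQA : Q.transpose * A.toBlocks₂₂ = 1 := by
    ext j k
    have h1 : P.Ω x (P.dualFamily v' (Sum.inr j)) (v' (Sum.inr k)) = (1 : Matrix κ κ ℂ) j k := by
      rw [P.Ω_dualFamily h']
      simp [Matrix.one_apply]
    rw [← h1, hA (Sum.inr k), Fintype.sum_sum_type, map_add, map_sum, map_sum,
      Finset.sum_eq_zero, zero_add]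
    · simp [Matrix.mul_apply, Q, Matrix.toBlocks₂₂, mul_comm]
    · intro i _
      rw [map_smul, hperp' j _ (hS ▸ Submodule.subset_span ⟨i, rfl⟩), smul_zero]
  have hdetQ : Q.det * A.toBlocks₂₂.det = 1 := by
    rw [← Q.det_transpose, ← Matrix.det_mul, hQA, Matrix.det_one]
  have hΩ : (P.omegaMatrix v').det = A.det ^ 2 * (P.omegaMatrix v).det := by
    conv_lhs => rw [funext hA, omegaMatrix_sum_smul, Matrix.det_mul, Matrix.det_mul,
      Matrix.det_transpose]
    ring
  have hA0 : A.det ≠ 0 := fun h0 => h' (by rw [hΩ, h0]; ring)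
  have hA1 : A.toBlocks₁₁.det ≠ 0 := fun h0 => hA0 (by rw [hdetA, h0, zero_mul])
  have hA2 : A.toBlocks₂₂.det ≠ 0 := right_ne_zero_of_mul_eq_one hdetQ
  have hQ0 : Q.det ≠ 0 := left_ne_zero_of_mul_eq_one hdetQ
  have hv' : (fun i => v' (Sum.inl i)) =
      fun j => ∑ i, A.toBlocks₁₁ i j • v (Sum.inl i) := by
    ext j
    rw [hA (Sum.inl j), Fintype.sum_sum_type]
    rw [Finset.sum_eq_zero (s := (Finset.univ : Finset κ)), add_zero]
    · rfl
    · intro i _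
      have : A (Sum.inr i) (Sum.inl j) = 0 := congrFun (congrFun hA21 i) j
      rw [this, zero_smul]
  have e1 := log_gramMatrix_sum_smul c
    ((P.linearIndependent_of_det_ne_zero h).comp _ Sum.inl_injective) hA1
  have e2 := log_gramMatrix_sum_smul c
    ((P.linearIndependent_dualFamily h).comp _ Sum.inr_injective) hQ0
  have e3 : Real.log ‖(P.omegaMatrix v').det‖ = 2 * (Real.log ‖A.toBlocks₁₁.det‖ +
      Real.log ‖A.toBlocks₂₂.det‖) + Real.log ‖(P.omegaMatrix v).det‖ := by
    rw [hΩ, hdetA, norm_mul, norm_pow, norm_mul, Real.log_mul (by simp [hA1, hA2])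
      (by simpa using h), Real.log_pow, Real.log_mul (by simpa using hA1) (by simpa using hA2)]
    norm_num
  have e4 : Real.log ‖Q.det‖ + Real.log ‖A.toBlocks₂₂.det‖ = 0 := by
    rw [← Real.log_mul (by simpa using hQ0) (by simpa using hA2), ← norm_mul, hdetQ]
    simp
  simp only [Function.comp_def] at e1 e2
  unfold logVolumeRatio
  rw [hv', funext hQ, e1, e2, e3]
  linear_combination (-2) * e4

lemma logVolumeRatio_congr {x : X} (c : InnerProductSpace.Core ℂ (W x)) {r q r' q' : ℕ}
    (hr : r = r') (hq : q = q') {v : Fin r ⊕ Fin q → W x} {v' : Fin r' ⊕ Fin q' → W x}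
    (h : (P.omegaMatrix v).det ≠ 0) (h' : (P.omegaMatrix v').det ≠ 0)
    (hs : Submodule.span ℂ (range v) = ⊤) (hs' : Submodule.span ℂ (range v') = ⊤)
    (hS : Submodule.span ℂ (range fun i => v (Sum.inl i)) =
      Submodule.span ℂ (range fun i => v' (Sum.inl i))) :
    P.logVolumeRatio c v = P.logVolumeRatio c v' := by
  subst hr hq
  exact P.logVolumeRatio_eq c h h' hs hs' hS

namespace Completion

variable {P} {S : ∀ x, Submodule ℂ (W x)} {x₀ : X}
  {e : HolFrame (Fin (2 * n) → ℂ) S x₀} (c : P.Completion e)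

lemma logVolumeRatio_full (h : HermitianMetric (Fin (2 * n) → ℂ) W) (x : X) :
    P.logVolumeRatio (h.core x) (c.full x) =
      logGram h c.perpFrame x + Real.log ‖(P.omegaMatrix (c.full x)).det‖ - logGram h e x := rfl

lemma logVolumeRatio_full_eq {x₁ : X} {e' : HolFrame (Fin (2 * n) → ℂ) S x₁}
    (c' : P.Completion e') (h : HermitianMetric (Fin (2 * n) → ℂ) W) {x : X} (hx : x ∈ c.dom)
    (hx' : x ∈ c'.dom) :
    P.logVolumeRatio (h.core x) (c.full x) = P.logVolumeRatio (h.core x) (c'.full x) := by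
  have hr : e.rank = e'.rank := by
    rw [HolSubbundle.rank_eq_finrank e (c.dom_subset hx),
      HolSubbundle.rank_eq_finrank e' (c'.dom_subset hx')]
  have hq : c.corank = c'.corank := by
    have h1 := c.rank_add_corank
    have h2 := c'.rank_add_corank
    omega
  exact P.logVolumeRatio_congr _ hr hq (c.det_full_ne_zero hx) (c'.det_full_ne_zero hx')
    (c.span_full hx) (c'.span_full hx')
    ((e.span_eq x (c.dom_subset hx)).trans (e'.span_eq x (c'.dom_subset hx')).symm)

lemma contMDiffOn_logVolumeRatio (h : HermitianMetric (Fin (2 * n) → ℂ) W) :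
    ContMDiffOn 𝓘(ℝ, ℂ) 𝓘(ℝ) ∞ (fun x => P.logVolumeRatio (h.core x) (c.full x)) c.dom := by
  have h1 : ContMDiffOn 𝓘(ℝ, ℂ) 𝓘(ℝ) ∞ (fun x => Real.log ‖(P.omegaMatrix (c.full x)).det‖)
      c.dom := by
    intro x hx
    have h0 := c.det_full_ne_zero hx
    have h2 : ContDiffAt ℝ ∞ (fun z : ℂ => Real.log ‖z‖) (P.omegaMatrix (c.full x)).det :=
      (contDiffAt_norm ℝ h0).log (by simpa using h0)
    exact ContMDiffAt.comp_contMDiffWithinAt (g := fun z : ℂ => Real.log ‖z‖) x h2.contMDiffAt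
      (contMDiffOn_real_of_complex c.contMDiffOn_det_full x hx)
  simp only [logVolumeRatio_full]
  exact ((contMDiffOn_logGram h c.perpFrame).add h1).sub
    ((contMDiffOn_logGram h e).mono c.dom_subset)

end Completion

end VolumeRatio

/-! ### Equality of the degrees of a subbundle and its perpendicular. -/

section Degree

variable {X : Type*} [TopologicalSpace X] [ChartedSpace ℂ X]
  {n : ℕ}
  {L : X → Type*} [TopologicalSpace (TotalSpace ℂ L)]
  [∀ x, AddCommGroup (L x)] [∀ x, Module ℂ (L x)] [∀ x, TopologicalSpace (L x)]
  [∀ x, IsTopologicalAddGroup (L x)] [∀ x, ContinuousSMul ℂ (L x)]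
  [FiberBundle ℂ L] [VectorBundle ℂ ℂ L]
  {W : X → Type*} [TopologicalSpace (TotalSpace (Fin (2 * n) → ℂ) W)]
  [∀ x, AddCommGroup (W x)] [∀ x, Module ℂ (W x)] [∀ x, TopologicalSpace (W x)]
  [∀ x, IsTopologicalAddGroup (W x)] [∀ x, ContinuousSMul ℂ (W x)]
  [FiberBundle (Fin (2 * n) → ℂ) W] [VectorBundle ℂ (Fin (2 * n) → ℂ) W]
  (P : HiggsPair X n L W)

lemma contDiffAt_comp_chart_symm [IsManifold 𝓘(ℝ, ℂ) ∞ X] {f : X → ℝ} {i : X} {z : ℂ}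
    (hz : z ∈ (chartAt ℂ i).target)
    (hf : ContMDiffAt 𝓘(ℝ, ℂ) 𝓘(ℝ) ∞ f ((chartAt ℂ i).symm z)) :
    ContDiffAt ℝ ∞ (fun w => f ((chartAt ℂ i).symm w)) z := by
  have h : ContMDiffAt 𝓘(ℝ, ℂ) 𝓘(ℝ, ℂ) ∞ (chartAt ℂ i).symm z :=
    contMDiffOn_chart_symm.contMDiffAt ((chartAt ℂ i).open_target.mem_nhds hz)
  exact contMDiffAt_iff_contDiffAt.1 (hf.comp z h)

lemma harmonicAt_log_norm_comp_chart_symm [IsManifold 𝓘(ℂ) ω X] {f : X → ℂ} {i : X} {z : ℂ}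
    (hz : z ∈ (chartAt ℂ i).target)
    (hf : ContMDiffAt 𝓘(ℂ) 𝓘(ℂ) ω f ((chartAt ℂ i).symm z))
    (h0 : f ((chartAt ℂ i).symm z) ≠ 0) :
    InnerProductSpace.HarmonicAt (fun w => Real.log ‖f ((chartAt ℂ i).symm w)‖) z := by
  have h : ContMDiffAt 𝓘(ℂ) 𝓘(ℂ) ω (chartAt ℂ i).symm z :=
    contMDiffOn_chart_symm.contMDiffAt ((chartAt ℂ i).open_target.mem_nhds hz)
  exact (contMDiffAt_iff_contDiffAt.1 (hf.comp z h)).analyticAt.harmonicAt_log_norm h0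

variable [IsManifold 𝓘(ℂ) ω X]

/-- The density at `z` involves only the frame attached to the point over `z`. Near it the two
logarithms differ by `log |det|` of a nonvanishing holomorphic function, which the Laplacian kills.
-/
lemma chernDensity_perpFrame {S : ∀ x, Submodule ℂ (W x)}
    {e : ∀ x, HolFrame (Fin (2 * n) → ℂ) S x} (c : ∀ x, P.Completion (e x))
    {h h' : HermitianMetric (Fin (2 * n) → ℂ) W}
    (hh : ∀ x, ∀ y ∈ (c x).dom, logGram h' (c x).perpFrame y =
      logGram h (e x) y - Real.log ‖(P.omegaMatrix ((c x).full y)).det‖)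
    {i : X} {z : ℂ} (hz : z ∈ (chartAt ℂ i).target) :
    chernDensity h' (fun x => (c x).perpFrame) (chartAt ℂ i) z =
      chernDensity h e (chartAt ℂ i) z := by
  have := isManifold_real X
  set x := (chartAt ℂ i).symm z with hx
  have hdom : (c x).dom ∈ 𝓝 x := (c x).isOpen_dom.mem_nhds (c x).mem_dom
  have hev : (fun w => logGram h' (c x).perpFrame ((chartAt ℂ i).symm w)) =ᶠ[𝓝 z]
      (fun w => logGram h (e x) ((chartAt ℂ i).symm w)) -
        fun w => Real.log ‖(P.omegaMatrix ((c x).full ((chartAt ℂ i).symm w))).det‖ := by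
    filter_upwards [((chartAt ℂ i).continuousAt_symm hz).preimage_mem_nhds hdom] with w hw
    exact hh x _ hw
  have hsmooth : ContDiffAt ℝ ∞ (fun w => logGram h (e x) ((chartAt ℂ i).symm w)) z :=
    contDiffAt_comp_chart_symm hz
      ((contMDiffOn_logGram h (e x)).contMDiffAt ((e x).isOpen_dom.mem_nhds (e x).mem_dom))
  have hharm := harmonicAt_log_norm_comp_chart_symm hz
    ((c x).contMDiffOn_det_full.contMDiffAt hdom) ((c x).det_full_ne_zero (c x).mem_dom)
  unfold chernDensity
  congr 1
  rw [← hx, (InnerProductSpace.laplacian_congr_nhds hev).eq_of_nhds,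
    (hsmooth.of_le (WithTop.coe_le_coe.2 le_top)).laplacian_sub hharm.1, hharm.2.eq_of_nhds]
  simp

variable [ContMDiffVectorBundle ω (Fin (2 * n) → ℂ) W 𝓘(ℂ)] [ConnectedSpace X]

/-- For a fixed metric the two densities differ by the Laplacian of a global function. Absorbing it
in a conformal factor makes the integrands equal, so Stokes' theorem is not needed. -/
lemma HasDegree.perpBundle {S : HolSubbundle (Fin (2 * n) → ℂ) W} {d : ℝ} (hd : HasDegree S d)
    (hS : ∃ x, S.fiber x ≠ ⊤) : HasDegree (P.perpBundle S) d := by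
  obtain ⟨h, e, ρ, hρ, rfl⟩ := hd
  let c : ∀ x, P.Completion (e x) := fun x => (P.exists_completion (e x)).some
  obtain ⟨x₁, hx₁⟩ := hS
  set q := (c x₁).corank with hq
  have hcorank : ∀ x, (c x).corank = q := fun x => by
    have h1 := (c x).rank_add_corank
    have h2 := (c x₁).rank_add_corank
    rw [HolSubbundle.rank_eq_finrank _ (e _).mem_dom] at h1 h2
    have h3 := S.finrank_fiber_eq x x₁
    omega
  -- The conformal factor divides by the rank `q` of the perpendicular, nonzero because `S` is not
  -- everything.
  have hq0 : (q : ℝ) ≠ 0 := by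
    intro h0
    have h1 : (e x₁).rank = 2 * n := by
      have := (c x₁).rank_add_corank
      have : q = 0 := by exact_mod_cast h0
      omega
    have := P.finiteDimensional_fiber x₁
    refine hx₁ (Submodule.eq_top_of_finrank_eq ?_)
    rw [← HolSubbundle.rank_eq_finrank _ (e _).mem_dom, h1, P.finrank_fiber]
  -- The solution of `q * p + logGram h S^⊥ = logGram h S - log |det Ω|`. The completions are chosen
  -- point by point, but the ratio does not depend on them, so `p` is smooth.
  let p : X → ℝ := fun x => -(P.logVolumeRatio (h.core x) ((c x).full x)) / q
  have hp_eq : ∀ x, ∀ y ∈ (c x).dom,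
      p y = -(P.logVolumeRatio (h.core y) ((c x).full y)) / q := fun x y hy => by
    simp only [p, (c y).logVolumeRatio_full_eq (c x) h (c y).mem_dom hy]
  have hp : ContMDiff 𝓘(ℝ, ℂ) 𝓘(ℝ) ∞ p := by
    intro x
    have hdom : (c x).dom ∈ 𝓝 x := (c x).isOpen_dom.mem_nhds (c x).mem_dom
    have h1 := ((c x).contMDiffOn_logVolumeRatio h).contMDiffAt hdom
    have h2 : ContDiff ℝ ∞ fun t : ℝ => -t / q := by fun_prop
    refine (h2.contMDiff.contMDiffAt.comp x h1).congr_of_eventuallyEq ?_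
    filter_upwards [hdom] with y hy
    exact hp_eq x y hy
  refine ⟨h.conformal p hp, fun x => (c x).perpFrame, ρ, hρ, ?_⟩
  refine finsum_congr fun i => ?_
  refine MeasureTheory.setIntegral_congr_fun (chartAt ℂ i).open_target.measurableSet fun z hz => ?_
  refine congrArg (ρ i ((chartAt ℂ i).symm z) * ·)
    (P.chernDensity_perpFrame c (fun x y hy => ?_) hz).symm
  rw [logGram_conformal h hp _ hy, hp_eq x y hy, (c x).logVolumeRatio_full]
  have : ((c x).perpFrame.rank : ℝ) = q := by exact_mod_cast hcorank x
  rw [this]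
  field_simp
  ring

lemma hasDegree_perpBundle_iff {S : HolSubbundle (Fin (2 * n) → ℂ) W} {d : ℝ}
    (h0 : ∃ x, S.fiber x ≠ ⊥) (h1 : ∃ x, S.fiber x ≠ ⊤) :
    HasDegree (P.perpBundle S) d ↔ HasDegree S d := by
  refine ⟨fun h => ?_, fun h => HasDegree.perpBundle P h h1⟩
  obtain ⟨x, hx⟩ := h0
  have := HasDegree.perpBundle P h
    ⟨x, fun htop => hx (P.perp_injective x (htop.trans (P.perp_bot x).symm))⟩
  rwa [perpBundle_perpBundle] at this

/-- A subbundle and its perpendicular have the same degree. -/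
lemma degree_perpBundle {S : HolSubbundle (Fin (2 * n) → ℂ) W}
    (h0 : ∃ x, S.fiber x ≠ ⊥) (h1 : ∃ x, S.fiber x ≠ ⊤) :
    (P.perpBundle S).degree = S.degree := by
  unfold HolSubbundle.degree
  -- `degree` depends only on the predicate `HasDegree S`, so equivalent predicates suffice.
  congr 1
  ext d
  exact P.hasDegree_perpBundle_iff h0 h1

end Degree

end HiggsPair

/-! ### The degree of the zero subbundle. -/

section DegreeZero

variable {X : Type*} [TopologicalSpace X] [ChartedSpace ℂ X] {m : ℕ}
  {W : X → Type*} [TopologicalSpace (TotalSpace (Fin m → ℂ) W)]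
  [∀ x, AddCommGroup (W x)] [∀ x, Module ℂ (W x)] [∀ x, TopologicalSpace (W x)]
  [FiberBundle (Fin m → ℂ) W] [VectorBundle ℂ (Fin m → ℂ) W]

/-- The frames are empty, so their Gram determinants are `1` and the logarithms vanish. -/
lemma HasDegree.eq_zero {S : HolSubbundle (Fin m → ℂ) W} (hS : ∀ x, S.fiber x = ⊥) {d : ℝ}
    (hd : HasDegree S d) : d = 0 := by
  obtain ⟨h, e, ρ, -, rfl⟩ := hd
  have hlog : ∀ x, logGram h (e x) = 0 := by
    intro x
    have hr : (e x).rank = 0 := by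
      rw [HolSubbundle.rank_eq_finrank (e x) (e x).mem_dom, hS, finrank_bot]
    have : IsEmpty (Fin (e x).rank) := by
      rw [hr]
      infer_instance
    ext y
    simp [logGram]
  have hc : ∀ i z, chernDensity h e (chartAt ℂ i) z = 0 := by
    intro i z
    simp only [chernDensity, hlog, Pi.zero_apply]
    rw [show (fun _ : ℂ => (0 : ℝ)) = fun _ => 0 from rfl, InnerProductSpace.laplacian_const]
    simp
  simp [hc]

/-- The zero subbundle has degree zero. -/
lemma degree_eq_zero [T2Space X] [CompactSpace X] [IsManifold 𝓘(ℂ) ω X]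
    [ContMDiffVectorBundle ω (Fin m → ℂ) W 𝓘(ℂ)] {S : HolSubbundle (Fin m → ℂ) W}
    (hS : ∀ x, S.fiber x = ⊥) : S.degree = 0 := by
  have := isManifold_real X
  obtain ⟨h⟩ := exists_hermitianMetric m W
  obtain ⟨ρ, hρ⟩ := SmoothPartitionOfUnity.exists_isSubordinate_chartAt_source 𝓘(ℝ, ℂ) X
  -- `epsilon` satisfies `HasDegree` only once some value does; this takes a metric and a partition
  -- of unity.
  exact HasDegree.eq_zero hS (Classical.epsilon_spec
    (p := HasDegree S) ⟨_, h, fun x => (S.exists_frame x).some, ρ, hρ, rfl⟩)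

end DegreeZero

/-! ## Filtrations -/

/-- By the modular law `w' = w ⊕ (w' ⊓ c)`, and `a` completes `w'`. The complement of `w` so
obtained contains `a`. -/
lemma isCompl_sup_inf {α : Type*} [Lattice α] [BoundedOrder α] [IsModularLattice α] {w w' a c : α}
    (hw : w ≤ w') (hc : IsCompl w c) (ha : IsCompl w' a) : IsCompl w (a ⊔ w' ⊓ c) := by
  constructor
  · have h1 : w' ⊓ (a ⊔ w' ⊓ c) = w' ⊓ c := by
      rw [inf_comm, sup_comm, sup_inf_assoc_of_le _ inf_le_left, inf_comm a, ha.inf_eq_bot,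
        sup_bot_eq]
    rw [disjoint_iff, ← inf_eq_left.2 hw, inf_assoc, h1, ← inf_assoc, inf_eq_left.2 hw,
      hc.inf_eq_bot]
  · have h1 : w ⊔ w' ⊓ c = w' := by
      rw [inf_comm, ← sup_inf_assoc_of_le _ hw, hc.sup_eq_top, top_inf_eq]
    rw [codisjoint_iff, sup_comm a, ← sup_assoc, h1, ha.sup_eq_top]

namespace HiggsPair

section Filtrations

variable {X : Type*} [TopologicalSpace X] [ChartedSpace ℂ X]
  {n : ℕ}
  {L : X → Type*} [TopologicalSpace (TotalSpace ℂ L)]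
  [∀ x, AddCommGroup (L x)] [∀ x, Module ℂ (L x)] [∀ x, TopologicalSpace (L x)]
  [∀ x, IsTopologicalAddGroup (L x)] [∀ x, ContinuousSMul ℂ (L x)]
  [FiberBundle ℂ L] [VectorBundle ℂ ℂ L]
  {W : X → Type*} [TopologicalSpace (TotalSpace (Fin (2 * n) → ℂ) W)]
  [∀ x, AddCommGroup (W x)] [∀ x, Module ℂ (W x)] [∀ x, TopologicalSpace (W x)]
  [∀ x, IsTopologicalAddGroup (W x)] [∀ x, ContinuousSMul ℂ (W x)]
  [FiberBundle (Fin (2 * n) → ℂ) W] [VectorBundle ℂ (Fin (2 * n) → ℂ) W]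
  (P : HiggsPair X n L W)
  [ContMDiffVectorBundle ω (Fin (2 * n) → ℂ) W 𝓘(ℂ)]

local notation "SubW" => HolSubbundle (Fin (2 * n) → ℂ) W

lemma isInvariant_perpBundle {S : SubW} (h : P.IsInvariant S) :
    P.IsInvariant (P.perpBundle S) :=
  fun x ξ => P.perp_invariant (h x ξ)

lemma isInvariant_sup {S T : SubW} (hS : P.IsInvariant S) (hT : P.IsInvariant T)
    (h : ∀ x, Disjoint (S.fiber x) (T.fiber x)) : P.IsInvariant (S.sup T h) := by
  intro x ξ v hv
  obtain ⟨a, ha, b, hb, rfl⟩ := Submodule.mem_sup.1 hv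
  rw [map_add]
  exact Submodule.add_mem_sup (hS x ξ a ha) (hT x ξ b hb)

lemma isInvariant_infBundle {S T : SubW} (hS : P.IsInvariant S) (hT : P.IsInvariant T)
    (h : ∀ x, Codisjoint (S.fiber x) (T.fiber x)) : P.IsInvariant (P.infBundle S T h) := by
  intro x ξ v hv
  rw [infBundle_fiber] at hv ⊢
  exact ⟨hS x ξ v hv.1, hT x ξ v hv.2⟩

lemma isInvariant_of_bot {S : SubW} (h : ∀ x, S.fiber x = ⊥) : P.IsInvariant S := by
  intro x ξ v hv
  rw [h x, Submodule.mem_bot] at hv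
  rw [hv, map_zero]
  exact Submodule.zero_mem _

lemma isInvariant_of_top {S : SubW} (h : ∀ x, S.fiber x = ⊤) : P.IsInvariant S := by
  intro x ξ v _
  rw [h x]
  exact Submodule.mem_top

variable {P} in
lemma IsIsotropic.le_perp {S : SubW} (h : P.IsIsotropic S) (x : X) :
    S.fiber x ≤ P.perp (S.fiber x) := fun v hv w hw => h x v hv w hw

variable {P} in
-- An isotropic fibre that is the whole of `W x` lies in its perpendicular `0`. So a point where `S`
-- is nonzero also shows that `S` is strict.
lemma IsIsotropic.eq_bot_or_isProper {S : SubW} (h : P.IsIsotropic S) :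
    (∀ x, S.fiber x = ⊥) ∨ S.IsProper := by
  by_cases h0 : ∀ x, S.fiber x = ⊥
  · exact Or.inl h0
  · obtain ⟨x, hx⟩ := not_forall.1 h0
    refine Or.inr ⟨⟨x, hx⟩, x, fun htop => hx ?_⟩
    have := h.le_perp x
    rw [htop, perp_top] at this
    rw [htop]
    exact le_bot_iff.1 this

/-! ### Opposite filtrations and splittings. -/

lemma exists_larger_complement {S S' C A : SubW} (hle : ∀ x, S.fiber x ≤ S'.fiber x)
    (hC : ∀ x, IsCompl (S.fiber x) (C.fiber x)) (hA : ∀ x, IsCompl (S'.fiber x) (A.fiber x))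
    (hS' : P.IsInvariant S') (hCi : P.IsInvariant C) (hAi : P.IsInvariant A) :
    ∃ B : SubW, (∀ x, IsCompl (S.fiber x) (B.fiber x)) ∧ P.IsInvariant B ∧
      ∀ x, A.fiber x ≤ B.fiber x := by
  have h1 : ∀ x, Codisjoint (S'.fiber x) (C.fiber x) := fun x => (hC x).codisjoint.mono_left (hle x)
  have h2 : ∀ x, Disjoint (A.fiber x) ((P.infBundle S' C h1).fiber x) := fun x => by
    rw [infBundle_fiber]
    exact (hA x).symm.disjoint.mono_right inf_le_left
  refine ⟨A.sup (P.infBundle S' C h1) h2, fun x => ?_,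
    P.isInvariant_sup hAi (P.isInvariant_infBundle hS' hCi h1) h2, fun x => le_sup_left⟩
  change IsCompl _ (A.fiber x ⊔ (P.infBundle S' C h1).fiber x)
  rw [infBundle_fiber]
  exact isCompl_sup_inf (hle x) (hC x) (hA x)

/-- Invariant complements of the terms of an increasing sequence of invariant subbundles can be
chosen to be decreasing. -/
lemma exists_decreasing_complements {w : ℕ → SubW} {l : ℕ}
    (hmono : ∀ i < l, ∀ x, (w i).fiber x ≤ (w (i + 1)).fiber x)
    (hinv : ∀ i ≤ l, P.IsInvariant (w i)) {C : ℕ → SubW}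
    (hC : ∀ i ≤ l, ∀ x, IsCompl ((w i).fiber x) ((C i).fiber x))
    (hCi : ∀ i ≤ l, P.IsInvariant (C i)) :
    ∃ A : ℕ → SubW, A l = C l ∧
      (∀ i ≤ l, (∀ x, IsCompl ((w i).fiber x) ((A i).fiber x)) ∧ P.IsInvariant (A i)) ∧
      ∀ i < l, ∀ x, (A (i + 1)).fiber x ≤ (A i).fiber x := by
  -- Downward induction from `l`. The last complement `C l` is kept, since duality later requires it
  -- to be the perpendicular of an isotropic subbundle.
  suffices ∀ d ≤ l, ∃ A : ℕ → SubW, A l = C l ∧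
      (∀ i ≤ l, l - d ≤ i →
        (∀ x, IsCompl ((w i).fiber x) ((A i).fiber x)) ∧ P.IsInvariant (A i)) ∧
      ∀ i < l, l - d ≤ i → ∀ x, (A (i + 1)).fiber x ≤ (A i).fiber x by
    obtain ⟨A, h0, h1, h2⟩ := this l le_rfl
    exact ⟨A, h0, fun i hi => h1 i hi (by omega), fun i hi => h2 i hi (by omega)⟩
  intro d
  induction d with
  | zero =>
    refine fun _ => ⟨C, rfl, fun i hi _ => ⟨hC i hi, hCi i hi⟩, fun i hi h => ?_⟩
    omega
  | succ d ih =>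
    intro hd
    obtain ⟨A, h0, h1, h2⟩ := ih (by omega)
    obtain ⟨j, hj⟩ : ∃ j, l = j + 1 + d := ⟨l - (d + 1), by omega⟩
    obtain ⟨B, hB, hBi, hAB⟩ := P.exists_larger_complement (hmono j (by omega)) (hC j (by omega))
      (h1 (j + 1) (by omega) (by omega)).1 (hinv (j + 1) (by omega)) (hCi j (by omega))
      (h1 (j + 1) (by omega) (by omega)).2
    refine ⟨Function.update A j B, ?_, fun i hi hij => ?_, fun i hi hij => ?_⟩
    · rw [Function.update_of_ne (by omega), h0]
    · rcases eq_or_ne i j with rfl | hne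
      · rw [Function.update_self]
        exact ⟨hB, hBi⟩
      · rw [Function.update_of_ne hne]
        exact h1 i hi (by omega)
    · rw [Function.update_of_ne (show i + 1 ≠ j by omega)]
      rcases eq_or_ne i j with rfl | hne
      · rw [Function.update_self]
        exact hAB
      · rw [Function.update_of_ne hne]
        exact h2 i hi (by omega)

/-- A self-dual invariant filtration whose isotropic terms have perpendiculars with isotropic
invariant complements has an opposite self-dual invariant filtration. -/
lemma exists_opposite_filtration {w : ℕ → SubW} {k : ℕ}
    (hmono : ∀ i < k, ∀ x, (w i).fiber x ≤ (w (i + 1)).fiber x)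
    (hperp : ∀ i ≤ k, ∀ x, (w (k - i)).fiber x = P.perp ((w i).fiber x))
    (hinv : ∀ i ≤ k, P.IsInvariant (w i))
    (hT : ∀ i, 2 * i ≤ k → ∃ T : SubW, P.IsIsotropic T ∧ P.IsInvariant T ∧
      ∀ x, IsCompl (P.perp ((w i).fiber x)) (T.fiber x)) :
    ∃ A : ℕ → SubW, (∀ i ≤ k, (∀ x, IsCompl ((w i).fiber x) ((A i).fiber x)) ∧
        P.IsInvariant (A i)) ∧
      (∀ i ≤ k, ∀ x, (A (k - i)).fiber x = P.perp ((A i).fiber x)) ∧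
      ∀ i < k, ∀ x, (A (i + 1)).fiber x ≤ (A i).fiber x := by
  obtain ⟨l, hl⟩ : ∃ l, k = 2 * l ∨ k = 2 * l + 1 := ⟨k / 2, by omega⟩
  have hT' : ∀ i, ∃ T : SubW, 2 * i ≤ k → P.IsIsotropic T ∧ P.IsInvariant T ∧
      ∀ x, IsCompl (P.perp ((w i).fiber x)) (T.fiber x) := fun i => by
    by_cases hi : 2 * i ≤ k
    · exact (hT i hi).imp fun _ h _ => h
    · exact ⟨w i, fun h => absurd h hi⟩
  choose T hT using hT'
  obtain ⟨A, hAl, hAc, hAa⟩ := P.exists_decreasing_complements (w := w) (l := l)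
    (C := fun i => P.perpBundle (T i))
    (fun i hi => hmono i (by omega)) (fun i hi => hinv i (by omega))
    (fun i hi x => by
      have := P.isCompl_perp ((hT i (by omega)).2.2 x)
      rwa [perp_perp] at this)
    (fun i hi => P.isInvariant_perpBundle (hT i (by omega)).2.1)
  have hco : ∀ x, P.perp ((A l).fiber x) ≤ (A l).fiber x := fun x => by
    rw [hAl]
    change P.perp (P.perp _) ≤ P.perp _
    rw [perp_perp]
    exact (hT l (by omega)).1.le_perp x
  -- In even length `w l` is Lagrangian. The perpendicular of `A l` lies in `A l` and both are
  -- complements of `w l`, so they coincide.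
  have hlag : k = 2 * l → ∀ x, P.perp ((A l).fiber x) = (A l).fiber x := fun hk x => by
    have h1 : (w l).fiber x = P.perp ((w l).fiber x) := by
      rw [← hperp l (by omega) x]
      congr 2
      omega
    have h2 := (hAc l le_rfl).1 x
    have h3 := P.isCompl_perp h2
    rw [← h1] at h3
    refine eq_of_le_of_inf_le_of_sup_le (hco x) (z := (w l).fiber x) ?_ ?_
    · rw [h2.symm.inf_eq_bot]
      exact bot_le
    · rw [h3.symm.sup_eq_top]
      exact le_top
  -- Prolong beyond the middle by duality.
  let B : ℕ → SubW := fun i => if i ≤ l then A i else P.perpBundle (A (k - i))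
  have hB1 : ∀ {i}, i ≤ l → B i = A i := fun hi => if_pos hi
  have hB2 : ∀ {i}, l < i → B i = P.perpBundle (A (k - i)) := fun hi => if_neg (by omega)
  refine ⟨B, fun i hi => ?_, fun i hi x => ?_, fun i hi x => ?_⟩
  · by_cases hil : i ≤ l
    · rw [hB1 hil]
      exact hAc i hil
    · rw [hB2 (by omega)]
      have h := hAc (k - i) (by omega)
      refine ⟨fun x => ?_, P.isInvariant_perpBundle h.2⟩
      have h1 := P.isCompl_perp (h.1 x)
      rwa [← hperp (k - i) (by omega) x, show k - (k - i) = i by omega] at h1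
  · by_cases hil : i ≤ l
    · rw [hB1 hil]
      by_cases hki : k - i ≤ l
      · have : i = l := by omega
        subst this
        rw [hB1 hki, show k - i = i by omega]
        exact (hlag (by omega) x).symm
      · rw [hB2 (by omega), show k - (k - i) = i by omega]
        rfl
    · rw [hB2 (i := i) (by omega), hB1 (by omega)]
      exact (P.perp_perp _).symm
  · rcases lt_trichotomy i l with hil | rfl | hil
    · rw [hB1 hil, hB1 hil.le]
      exact hAa i hil x
    · rw [hB1 le_rfl, hB2 (Nat.lt_succ_self i)]
      refine le_trans (P.perp_anti ?_) (hco x)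
      rcases hl with hl | hl
      · obtain ⟨j, rfl⟩ : ∃ j, i = j + 1 := ⟨i - 1, by omega⟩
        rw [show k - (j + 1 + 1) = j by omega]
        exact hAa j (by omega) x
      · rw [show k - (i + 1) = i by omega]
    · rw [hB2 hil, hB2 (by omega)]
      refine P.perp_anti ?_
      have := hAa (k - (i + 1)) (by omega) x
      rwa [show k - (i + 1) + 1 = k - i by omega] at this

/-- Take `V i = w (i + 1) ∩ A i` for the opposite filtration `A`. If `i + j + 1 < k`, then `V i` and
`V j` are perpendicular because of the terms of `w`; if `i + j + 1 > k`, because of those of `A`. -/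
lemma exists_splitting {w : ℕ → SubW} {k : ℕ}
    (hmono : ∀ i < k, ∀ x, (w i).fiber x ≤ (w (i + 1)).fiber x)
    (hperp : ∀ i ≤ k, ∀ x, (w (k - i)).fiber x = P.perp ((w i).fiber x))
    (hinv : ∀ i ≤ k, P.IsInvariant (w i))
    (hT : ∀ i, 2 * i ≤ k → ∃ T : SubW, P.IsIsotropic T ∧ P.IsInvariant T ∧
      ∀ x, IsCompl (P.perp ((w i).fiber x)) (T.fiber x)) :
    ∃ V : ℕ → SubW, ∀ i < k,
      (∀ x, Disjoint ((w i).fiber x) ((V i).fiber x) ∧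
        (w i).fiber x ⊔ (V i).fiber x = (w (i + 1)).fiber x) ∧
      (∀ j < k, i + j + 1 ≠ k → ∀ x, ∀ v ∈ (V i).fiber x, ∀ u ∈ (V j).fiber x, P.Ω x v u = 0) ∧
      P.IsInvariant (V i) := by
  obtain ⟨A, hAc, hAp, hAa⟩ := P.exists_opposite_filtration hmono hperp hinv hT
  have hw : ∀ i j, i ≤ j → j ≤ k → ∀ x, (w i).fiber x ≤ (w j).fiber x := by
    intro i j hij
    induction hij with
    | refl => exact fun _ x => le_rfl
    | step h ih => exact fun hk x => (ih (by omega) x).trans (hmono _ (by omega) x)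
  have hA : ∀ i j, i ≤ j → j ≤ k → ∀ x, (A j).fiber x ≤ (A i).fiber x := by
    intro i j hij
    induction hij with
    | refl => exact fun _ x => le_rfl
    | step h ih => exact fun hk x => (hAa _ (by omega) x).trans (ih (by omega) x)
  have hcod : ∀ i < k, ∀ x, Codisjoint ((w (i + 1)).fiber x) ((A i).fiber x) := fun i hi x =>
    ((hAc i hi.le).1 x).codisjoint.mono_left (hmono i hi x)
  let V : ℕ → SubW := fun i =>
    if h : i < k then P.infBundle (w (i + 1)) (A i) (hcod i h) else w 0
  have hV : ∀ i (h : i < k), V i = P.infBundle (w (i + 1)) (A i) (hcod i h) := fun i h => dif_pos h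
  have hVf : ∀ i < k, ∀ x, (V i).fiber x = (w (i + 1)).fiber x ⊓ (A i).fiber x := fun i h x => by
    rw [hV i h, infBundle_fiber]
  refine ⟨V, fun i hi => ⟨fun x => ?_, fun j hj hij x v hv u hu => ?_, ?_⟩⟩
  · have h := (hAc i hi.le).1 x
    rw [hVf i hi]
    refine ⟨h.disjoint.mono_right inf_le_right, ?_⟩
    rw [inf_comm, ← sup_inf_assoc_of_le _ (hmono i hi x), h.sup_eq_top, top_inf_eq]
  · rw [hVf i hi] at hv
    rw [hVf j hj] at hu
    rw [P.Ω_eq_zero_comm]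
    rcases lt_or_gt_of_ne hij with h | h
    · have h1 := hw (j + 1) (k - (i + 1)) (by omega) (by omega) x hu.1
      rw [hperp (i + 1) (by omega)] at h1
      exact h1 v hv.1
    · have h1 := hA (k - i) j (by omega) hj.le x hu.2
      rw [hAp i hi.le] at h1
      exact h1 v hv.2
  · rw [hV i hi]
    exact P.isInvariant_infBundle (hinv _ (by omega)) (hAc i hi.le).2 _

/-! ### Terms of a filtration at the jumps of the weights. -/

namespace Filtration

variable {P} {m : ℕ} (𝒲 : P.Filtration m)

lemma mono {i j : Fin (m + 2)} (h : i ≤ j) (x : X) :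
    (𝒲.sub i).fiber x ≤ (𝒲.sub j).fiber x := 𝒲.strict.monotone h x

lemma sub_rev (i : Fin (m + 2)) : 𝒲.sub i.rev = P.perpBundle (𝒲.sub i) :=
  HolSubbundle.ext_fiber (𝒲.perp_eq i)

lemma isIsotropic {i : Fin (m + 2)} (h : i ≤ i.rev) : P.IsIsotropic (𝒲.sub i) := by
  intro x v hv w hw
  have := 𝒲.mono h x hv
  rw [𝒲.perp_eq] at this
  exact this w hw

lemma exists_ne_bot {i : Fin (m + 2)} (h : i ≠ 0) : ∃ x, (𝒲.sub i).fiber x ≠ ⊥ := by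
  by_contra! hbot
  exact (𝒲.strict (Fin.pos_of_ne_zero h)).ne (funext fun x => (𝒲.bot x).trans (hbot x).symm)

lemma exists_ne_top {i : Fin (m + 2)} (h : i ≠ Fin.last (m + 1)) :
    ∃ x, (𝒲.sub i).fiber x ≠ ⊤ := by
  by_contra! htop
  exact (𝒲.strict (Fin.lt_last_iff_ne_last.2 h)).ne
    (funext fun x => (htop x).trans (𝒲.top x).symm)

lemma isProper {i : Fin (m + 2)} (h0 : i ≠ 0) (h1 : i ≠ Fin.last (m + 1)) :
    (𝒲.sub i).IsProper := ⟨𝒲.exists_ne_bot h0, 𝒲.exists_ne_top h1⟩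

/-- At a jump, the weights not exceeding the lower one belong to terms contained in the given one,
so the supremum in `Compatible` is contained in that term. -/
lemma isInvariant_of_lt {lam : Fin (m + 1) → ℝ} (hl : Monotone lam) (hc : 𝒲.Compatible lam)
    {j : Fin m} (hj : lam j.castSucc < lam j.succ) : P.IsInvariant (𝒲.sub j.succ.castSucc) := by
  intro x ξ v hv
  have h := hc x ξ j.castSucc v (by rwa [Fin.succ_castSucc])
  refine (iSup₂_le fun i hi => 𝒲.mono ?_ x) h
  have : i < j.succ := lt_of_not_ge fun hle => (hi.trans_lt hj).not_ge (hl hle)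
  rw [Fin.lt_def] at this
  rw [Fin.le_def]
  simp only [Fin.val_succ, Fin.val_castSucc] at this ⊢
  omega

lemma compatible_of_isInvariant (h : ∀ i, P.IsInvariant (𝒲.sub i)) (lam : Fin (m + 1) → ℝ) :
    𝒲.Compatible lam := fun x ξ i v hv =>
  Submodule.mem_iSup_of_mem i (Submodule.mem_iSup_of_mem le_rfl (h i.succ x ξ v hv))

variable [IsManifold 𝓘(ℂ) ω X] [ConnectedSpace X]

/-- A term in the lower half is isotropic; one in the upper half is replaced by its perpendicular.
-/
lemma exists_isIsotropic_degree_eq {i : Fin (m + 2)} (h0 : i ≠ 0) (h1 : i ≠ Fin.last (m + 1))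
    (hi : P.IsInvariant (𝒲.sub i)) :
    ∃ S : SubW, S.IsProper ∧ P.IsIsotropic S ∧ P.IsInvariant S ∧
      S.degree = (𝒲.sub i).degree := by
  rcases le_total i i.rev with h | h
  · exact ⟨_, 𝒲.isProper h0 h1, 𝒲.isIsotropic h, hi, rfl⟩
  · refine ⟨𝒲.sub i.rev, 𝒲.isProper ?_ ?_, 𝒲.isIsotropic (by rwa [Fin.rev_rev]), ?_, ?_⟩
    · rwa [ne_eq, ← Fin.rev_last, Fin.rev_inj]
    · rwa [ne_eq, ← Fin.rev_zero, Fin.rev_inj]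
    · rw [sub_rev]
      exact P.isInvariant_perpBundle hi
    · rw [sub_rev]
      exact P.degree_perpBundle (𝒲.exists_ne_bot h0) (𝒲.exists_ne_top h1)

lemma degree_nonpos (hS : ∀ S : SubW, S.IsProper → P.IsIsotropic S → P.IsInvariant S →
    S.degree ≤ 0) {lam : Fin (m + 1) → ℝ} (hl : Monotone lam) (hc : 𝒲.Compatible lam) {j : Fin m}
    (hj : lam j.castSucc < lam j.succ) : (𝒲.sub j.succ.castSucc).degree ≤ 0 := by
  obtain ⟨S, h1, h2, h3, h4⟩ := 𝒲.exists_isIsotropic_degree_eq (i := j.succ.castSucc)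
    (by simp [Fin.ext_iff]) (Fin.castSucc_ne_last _) (𝒲.isInvariant_of_lt hl hc hj)
  exact h4 ▸ hS S h1 h2 h3

lemma term_nonneg (hS : ∀ S : SubW, S.IsProper → P.IsIsotropic S → P.IsInvariant S →
    S.degree ≤ 0) {lam : Fin (m + 1) → ℝ} (hl : Monotone lam) (hc : 𝒲.Compatible lam) (j : Fin m) :
    0 ≤ (lam j.castSucc - lam j.succ) * (𝒲.sub j.succ.castSucc).degree := by
  rcases (hl (Fin.castSucc_le_succ j)).eq_or_lt with h | h
  · rw [h, sub_self, zero_mul]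
  · exact mul_nonneg_of_nonpos_of_nonpos (sub_nonpos.2 h.le) (𝒲.degree_nonpos hS hl hc h)

end Filtration

/-! ### Filtrations from isotropic subbundles, and the criteria. -/

variable [IsManifold 𝓘(ℂ) ω X] [ConnectedSpace X]

/-- The filtration `0 ⊂ S ⊆ S^⊥ ⊂ W` defined by an isotropic subbundle, with strictly increasing
weights. -/
lemma exists_filtration {S : SubW} (hp : S.IsProper) (hS : P.IsIsotropic S)
    (hi : P.IsInvariant S) :
    ∃ (m : ℕ) (𝒲 : P.Filtration m), ∃ lam ∈ weights m, StrictMono lam ∧ lam ≠ 0 ∧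
      𝒲.Compatible lam ∧ 𝒲.deg lam = -2 * S.degree ∧
      (𝒲.Splits → ∃ T : SubW, P.IsIsotropic T ∧ P.IsInvariant T ∧
        ∀ x, IsCompl (P.perp (S.fiber x)) (T.fiber x)) := by
  let Z : SubW := HolSubbundle.zero _ _
  have hZ : ∀ x, Z.fiber x = ⊥ := fun x => rfl
  have hZp : ∀ x, (P.perpBundle Z).fiber x = ⊤ := fun x => P.perp_bot x
  have hZS : Z.fiber < S.fiber := lt_of_le_of_ne (fun x => bot_le) fun h => by
    obtain ⟨x, hx⟩ := hp.1
    exact hx (congrFun h x).symm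
  have hSZ : (P.perpBundle S).fiber < (P.perpBundle Z).fiber :=
    lt_of_le_of_ne (fun x => (hZp x).symm ▸ le_top) fun h => by
      obtain ⟨x, hx⟩ := hp.1
      exact hx (P.perp_injective x (congrFun h x))
  have hT : ∀ T : SubW, P.IsIsotropic T → P.IsInvariant T →
      (∀ x, Disjoint ((P.perpBundle S).fiber x) (T.fiber x) ∧
        (P.perpBundle S).fiber x ⊔ T.fiber x = (P.perpBundle Z).fiber x) →
      ∃ T : SubW, P.IsIsotropic T ∧ P.IsInvariant T ∧
        ∀ x, IsCompl (P.perp (S.fiber x)) (T.fiber x) := fun T h1 h2 h3 =>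
    ⟨T, h1, h2, fun x => ⟨(h3 x).1, codisjoint_iff.2 ((h3 x).2.trans (hZp x))⟩⟩
  -- The terms of a filtration are distinct, so a Lagrangian `S` gets a filtration of length two
  -- instead of three.
  by_cases hlag : P.perpBundle S = S
  · let 𝒲 : P.Filtration 1 :=
      { sub := ![Z, S, P.perpBundle Z]
        strict := Fin.strictMono_iff_lt_succ.2 fun i => by
          fin_cases i
          · exact hZS
          · exact hlag ▸ hSZ
        bot := hZ
        top := hZp
        perp_eq := fun i x => by
          fin_cases i
          · rfl
          · exact congrArg (fun T : SubW => T.fiber x) hlag.symm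
          · exact (P.perp_perp _).symm }
    refine ⟨1, 𝒲, ![-1, 1], ⟨?_, ?_⟩, ?_, ?_, 𝒲.compatible_of_isInvariant ?_ _, ?_, ?_⟩
    · exact Fin.monotone_iff_le_succ.2 fun i => by fin_cases i; norm_num
    · intro i
      fin_cases i <;> simp
    · exact Fin.strictMono_iff_lt_succ.2 fun i => by fin_cases i; norm_num
    · intro h
      simpa using congrFun h 0
    · intro i
      fin_cases i
      exacts [P.isInvariant_of_bot hZ, hi, P.isInvariant_of_top hZp]
    · have : 𝒲.deg ![-1, 1] = ∑ j : Fin 1, ((![-1, 1] : Fin 2 → ℝ) j.castSucc -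
        (![-1, 1] : Fin 2 → ℝ) j.succ) * (𝒲.sub j.succ.castSucc).degree := rfl
      rw [this, Fin.sum_univ_one]
      change ((-1 : ℝ) - 1) * S.degree = _
      norm_num
    · rintro ⟨V, h1, h2, h3⟩
      refine hT (V 1) (fun x => h2 1 1 (by decide) x) (h3 1) fun x => ?_
      rw [hlag]
      exact h1 1 x
  · have hSS : S.fiber < (P.perpBundle S).fiber :=
      lt_of_le_of_ne hS.le_perp fun h =>
        hlag (HolSubbundle.ext_fiber fun x => (congrFun h x).symm)
    let 𝒲 : P.Filtration 2 :=
      { sub := ![Z, S, P.perpBundle S, P.perpBundle Z]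
        strict := Fin.strictMono_iff_lt_succ.2 fun i => by
          fin_cases i
          exacts [hZS, hSS, hSZ]
        bot := hZ
        top := hZp
        perp_eq := fun i x => by
          fin_cases i
          · rfl
          · rfl
          · exact (P.perp_perp _).symm
          · exact (P.perp_perp _).symm }
    refine ⟨2, 𝒲, ![-1, 0, 1], ⟨?_, ?_⟩, ?_, ?_, 𝒲.compatible_of_isInvariant ?_ _, ?_, ?_⟩
    · refine Fin.monotone_iff_le_succ.2 fun i => ?_
      fin_cases i
      exacts [neg_one_lt_zero.le, zero_le_one]
    · intro i
      fin_cases i <;> simp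
    · refine Fin.strictMono_iff_lt_succ.2 fun i => ?_
      fin_cases i
      exacts [neg_one_lt_zero, zero_lt_one]
    · intro h
      simpa using congrFun h 0
    · intro i
      fin_cases i
      exacts [P.isInvariant_of_bot hZ, hi, P.isInvariant_perpBundle hi, P.isInvariant_of_top hZp]
    · have : 𝒲.deg ![-1, 0, 1] = ∑ j : Fin 2, ((![-1, 0, 1] : Fin 3 → ℝ) j.castSucc -
        (![-1, 0, 1] : Fin 3 → ℝ) j.succ) * (𝒲.sub j.succ.castSucc).degree := rfl
      rw [this, Fin.sum_univ_two]
      change ((-1 : ℝ) - 0) * S.degree + (0 - 1) * (P.perpBundle S).degree = _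
      rw [P.degree_perpBundle hp.1 hp.2]
      ring
    · rintro ⟨V, h1, h2, h3⟩
      exact hT (V 2) (fun x => h2 2 2 (by decide) x) (h3 2) fun x => h1 2 x

lemma isSemistable_of_degree_nonpos (hS : ∀ S : SubW, S.IsProper → P.IsIsotropic S →
    P.IsInvariant S → S.degree ≤ 0) : P.IsSemistable := fun _ 𝒲 _ hlam hc =>
  Finset.sum_nonneg fun j _ => 𝒲.term_nonneg hS hlam.1 hc j

variable {P} in
lemma IsSemistable.degree_nonpos (h : P.IsSemistable) {S : SubW} (hp : S.IsProper)
    (hS : P.IsIsotropic S) (hi : P.IsInvariant S) : S.degree ≤ 0 := by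
  obtain ⟨m, 𝒲, lam, hlam, -, -, hc, hd, -⟩ := P.exists_filtration hp hS hi
  have := h m 𝒲 lam hlam hc
  linarith

lemma isSemistable_iff [T2Space X] [CompactSpace X] :
    P.IsSemistable ↔ ∀ S : SubW, P.IsIsotropic S → P.IsInvariant S → S.degree ≤ 0 := by
  refine ⟨fun h S hS hi => ?_, fun h => P.isSemistable_of_degree_nonpos fun S _ => h S⟩
  rcases hS.eq_bot_or_isProper with h0 | hp
  · exact (degree_eq_zero h0).le
  · exact h.degree_nonpos hp hS hi

lemma isStable_iff :
    P.IsStable ↔ ∀ S : SubW, S.IsProper → P.IsIsotropic S → P.IsInvariant S → S.degree < 0 := by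
  refine ⟨fun h S hp hS hi => ?_, fun h => ⟨P.isSemistable_of_degree_nonpos
    fun S hp hS hi => (h S hp hS hi).le, fun m 𝒲 lam hlam h0 hc => ?_⟩⟩
  · obtain ⟨m, 𝒲, lam, hlam, -, h0, hc, hd, -⟩ := P.exists_filtration hp hS hi
    have := h.2 m 𝒲 lam hlam h0 hc
    linarith
  -- A nonzero weight jumps somewhere: a constant one is zero by its antisymmetry.
  · obtain ⟨j, hj⟩ : ∃ j : Fin m, lam j.castSucc < lam j.succ := by
      by_contra! hle
      have hanti : Antitone lam := Fin.antitone_iff_succ_le.2 hle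
      refine h0 (funext fun i => ?_)
      have h1 := hlam.2 i
      have h2 : lam i.rev = lam i := by
        rcases le_total i i.rev with h | h
        · exact le_antisymm (hanti h) (hlam.1 h)
        · exact le_antisymm (hlam.1 h) (hanti h)
      rw [Pi.zero_apply]
      linarith
    refine Finset.sum_pos' (fun i _ => 𝒲.term_nonneg (fun S hp hS hi => (h S hp hS hi).le)
      hlam.1 hc i) ⟨j, Finset.mem_univ j, ?_⟩
    obtain ⟨S, h1, h2, h3, h4⟩ := 𝒲.exists_isIsotropic_degree_eq (i := j.succ.castSucc)
      (by simp [Fin.ext_iff]) (Fin.castSucc_ne_last _) (𝒲.isInvariant_of_lt hlam.1 hc hj)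
    exact mul_pos_of_neg_of_neg (sub_neg.2 hj) (h4 ▸ h S h1 h2 h3)

lemma Filtration.splits_of_complements {m : ℕ} (𝒲 : P.Filtration m)
    (hinv : ∀ i, P.IsInvariant (𝒲.sub i))
    (hT : ∀ i, i ≠ 0 → i ≠ Fin.last (m + 1) → P.IsIsotropic (𝒲.sub i) →
      ∃ T : SubW, P.IsIsotropic T ∧ P.IsInvariant T ∧
        ∀ x, IsCompl (P.perp ((𝒲.sub i).fiber x)) (T.fiber x)) : 𝒲.Splits := by
  -- `Fin.ofNat` wraps around modulo `m + 2`; only indices up to `m + 1` matter.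
  let w : ℕ → SubW := fun i => 𝒲.sub (Fin.ofNat (m + 2) i)
  have hw : ∀ i : Fin (m + 2), w i = 𝒲.sub i := fun i => by simp [w]
  have hw' : ∀ i (hi : i < m + 2), w i = 𝒲.sub ⟨i, hi⟩ := fun i hi => hw ⟨i, hi⟩
  obtain ⟨V, hV⟩ := P.exists_splitting (w := w) (k := m + 1)
    (fun i hi x => by
      rw [hw' i (by omega), hw' (i + 1) (by omega)]
      exact 𝒲.mono (by simp [Fin.le_def]) x)
    (fun i hi x => by
      rw [hw' i (by omega), hw' (m + 1 - i) (by omega), ← 𝒲.perp_eq]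
      congr 2
      simp only [Fin.ext_iff, Fin.val_rev]
      omega)
    (fun i hi => by
      rw [hw' i (by omega)]
      exact hinv _)
    (fun i hi => by
      rw [hw' i (by omega)]
      rcases Nat.eq_zero_or_pos i with rfl | hpos
      · refine ⟨HolSubbundle.zero _ _, fun x v hv u _ => ?_, P.isInvariant_of_bot fun x => rfl,
          fun x => ?_⟩
        · rw [(Submodule.mem_bot ℂ).1 hv]
          simp
        · have : (𝒲.sub ⟨0, by omega⟩).fiber x = ⊥ := 𝒲.bot x
          rw [this, P.perp_bot]
          exact isCompl_top_bot
      · refine hT _ (by simp [Fin.ext_iff]; omega) (by simp [Fin.ext_iff]; omega)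
          (𝒲.isIsotropic ?_)
        simp only [Fin.le_def, Fin.val_rev]
        omega)
  refine ⟨fun i => V i, fun i x => ?_, fun i j hij x => ?_, fun i => (hV i i.2).2.2⟩
  · have := (hV i i.2).1 x
    rwa [hw' i (by omega), hw' (i + 1) (by omega)] at this
  · refine (hV i i.2).2.1 j j.2 (fun h => hij ?_) x
    simp only [Fin.ext_iff, Fin.val_rev]
    omega

lemma isPolystable_iff :
    P.IsPolystable ↔ P.IsSemistable ∧
      ∀ S : SubW, S.IsProper → P.IsIsotropic S → P.IsInvariant S → S.degree = 0 →
        ∃ T : SubW, P.IsIsotropic T ∧ P.IsInvariant T ∧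
          ∀ x, IsCompl (P.perp (S.fiber x)) (T.fiber x) := by
  refine ⟨fun h => ⟨h.1, fun S hp hS hi hd => ?_⟩, fun h => ⟨h.1, fun m 𝒲 lam hlam hl hc hd => ?_⟩⟩
  · obtain ⟨m, 𝒲, lam, hlam, hl, -, hc, hdeg, hT⟩ := P.exists_filtration hp hS hi
    exact hT (h.2 m 𝒲 lam hlam hl hc (by rw [hdeg, hd, mul_zero]))
  · have hlt : ∀ j : Fin m, lam j.castSucc < lam j.succ := fun j => hl (Fin.castSucc_lt_succ)
    have hmid : ∀ i : Fin (m + 2), i ≠ 0 → i ≠ Fin.last (m + 1) →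
        ∃ j : Fin m, i = j.succ.castSucc := by
      intro i h0 h1
      obtain ⟨a, rfl⟩ := Fin.exists_castSucc_eq.2 h1
      obtain ⟨j, rfl⟩ := Fin.exists_succ_eq.2 fun h => h0 (congrArg Fin.castSucc h)
      exact ⟨j, rfl⟩
    refine Filtration.splits_of_complements P 𝒲 (fun i => ?_) fun i h0 h1 hiso => ?_
    · by_cases h0 : i = 0
      · exact P.isInvariant_of_bot (h0 ▸ 𝒲.bot)
      by_cases h1 : i = Fin.last (m + 1)
      · exact P.isInvariant_of_top (h1 ▸ 𝒲.top)
      obtain ⟨j, rfl⟩ := hmid i h0 h1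
      exact 𝒲.isInvariant_of_lt hlam.1 hc (hlt j)
    · obtain ⟨j, rfl⟩ := hmid i h0 h1
      refine h.2 _ (𝒲.isProper h0 h1) hiso (𝒲.isInvariant_of_lt hlam.1 hc (hlt j)) ?_
      -- A vanishing sum of nonnegative terms: each is zero, and its coefficient is negative, so its
      -- degree vanishes.
      have := (Finset.sum_eq_zero_iff_of_nonneg fun j _ => 𝒲.term_nonneg
        (fun S hp hS hi => h.1.degree_nonpos hp hS hi) hlam.1 hc j).1 hd j (Finset.mem_univ j)
      exact (mul_eq_zero.1 this).resolve_left (sub_neg.2 (hlt j)).ne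

/-- `S ≤ S^⊥` gives `S^⊥ + T = W`, and `T ≤ T^⊥` gives `S^⊥ ∩ T ≤ S^⊥ ∩ T^⊥ = 0`. So the same `T`
serves for `S^⊥`. -/
lemma isPolystable_of_isotropic_complements (h : P.IsSemistable)
    (hT : ∀ S : SubW, S.IsProper → P.IsIsotropic S → P.IsInvariant S → S.degree = 0 →
      ∃ T : SubW, P.IsIsotropic T ∧ P.IsInvariant T ∧
        ∀ x, IsCompl (S.fiber x) (T.fiber x)) : P.IsPolystable := by
  refine P.isPolystable_iff.2 ⟨h, fun S hp hS hi hd => ?_⟩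
  obtain ⟨T, h1, h2, h3⟩ := hT S hp hS hi hd
  exact ⟨T, h1, h2, fun x => ⟨(P.isCompl_perp (h3 x)).disjoint.mono_right (h1.le_perp x),
    (h3 x).codisjoint.mono_left (hS.le_perp x)⟩⟩

end Filtrations

end HiggsPair

end SpHiggs

end

theorem mainTheorem9
    {X : Type*} [TopologicalSpace X] [T2Space X] [CompactSpace X] [ConnectedSpace X]
    [ChartedSpace ℂ X] [IsManifold 𝓘(ℂ) ω X]
    (n : ℕ)
    {L : X → Type*} [TopologicalSpace (TotalSpace ℂ L)]
    [∀ x, AddCommGroup (L x)] [∀ x, Module ℂ (L x)] [∀ x, TopologicalSpace (L x)]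
    [∀ x, IsTopologicalAddGroup (L x)] [∀ x, ContinuousSMul ℂ (L x)]
    [FiberBundle ℂ L] [VectorBundle ℂ ℂ L] [ContMDiffVectorBundle ω ℂ L 𝓘(ℂ)]
    {W : X → Type*} [TopologicalSpace (TotalSpace (Fin (2 * n) → ℂ) W)]
    [∀ x, AddCommGroup (W x)] [∀ x, Module ℂ (W x)] [∀ x, TopologicalSpace (W x)]
    [∀ x, IsTopologicalAddGroup (W x)] [∀ x, ContinuousSMul ℂ (W x)]
    [FiberBundle (Fin (2 * n) → ℂ) W] [VectorBundle ℂ (Fin (2 * n) → ℂ) W]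
    [ContMDiffVectorBundle ω (Fin (2 * n) → ℂ) W 𝓘(ℂ)]
    (P : SpHiggs.HiggsPair X n L W) :
    (P.IsSemistable ↔
      ∀ S : SpHiggs.HolSubbundle (Fin (2 * n) → ℂ) W,
        P.IsIsotropic S → P.IsInvariant S → S.degree ≤ 0) ∧
    (P.IsStable ↔
      ∀ S : SpHiggs.HolSubbundle (Fin (2 * n) → ℂ) W,
        S.IsProper → P.IsIsotropic S → P.IsInvariant S → S.degree < 0) ∧
    ((P.IsSemistable ∧
        ∀ S : SpHiggs.HolSubbundle (Fin (2 * n) → ℂ) W,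
          S.IsProper → P.IsIsotropic S → P.IsInvariant S → S.degree = 0 →
            ∃ T : SpHiggs.HolSubbundle (Fin (2 * n) → ℂ) W,
              P.IsIsotropic T ∧ P.IsInvariant T ∧ ∀ x, IsCompl (S.fiber x) (T.fiber x)) →
      P.IsPolystable) ∧
    (P.IsPolystable ↔
      P.IsSemistable ∧
        ∀ S : SpHiggs.HolSubbundle (Fin (2 * n) → ℂ) W,
          S.IsProper → P.IsIsotropic S → P.IsInvariant S → S.degree = 0 →
            ∃ T : SpHiggs.HolSubbundle (Fin (2 * n) → ℂ) W,
              P.IsIsotropic T ∧ P.IsInvariant T ∧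
                ∀ x, IsCompl (P.perp (S.fiber x)) (T.fiber x)) := by
  exact ⟨P.isSemistable_iff, P.isStable_iff,
    fun h => P.isPolystable_of_isotropic_complements h.1 h.2, P.isPolystable_iff⟩
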